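/- Let $d\ge 3$ be an odd integer. Let $\mathrm{Rat}_d$ be the space of complex rational maps of degree $d$, topologized as the open subset of $\mathbb P^{2d+1}_{\mathbb C}$ of coefficient classes $[a_0:\cdots:a_d:b_0:\cdots:b_d]$ for which $\phi(z)=\sum_{k=0}^d a_kz^k\big/\sum_{k=0}^d b_kz^k$ has degree exactly $d$ (classical topology). Let $\mathrm{PSL}_2(\mathbb C)$ act on $\mathrm{Rat}_d$ by conjugation $\phi\mapsto T\circ\phi\circ T^{-1}$, and let $\mathrm M_d=\mathrm{Rat}_d/\mathrm{PSL}_2(\mathbb C)$ be the moduli space, with the quotient topology. A map $\phi\in\mathrm{Rat}_d$ is called real if it is conjugate by a Möbius transformation to a rational map with real coefficients; it is called pseudo-real if it is not real but it commutes with some extended Möbius transformation $z\mapsto T(\overline z)$, $T\in\mathrm{PSL}_2(\mathbb C)$. Let $\mathcal B_d^{\mathbb R}\subset \mathrm M_d$ be the set of conjugacy classes of pseudo-real rational maps of degree $d$. Then $\mathcal B_d^{\mathbb R}$, with the subspace topology, is not connected: it is the union of two disjoint non-empty relatively open subsets. (In particular $\mathcal B_d^{\mathbb R}$ is non-empty.)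 -/

import Mathlib

open scoped Polynomial

noncomputable section

namespace RationalMap

/-- The polynomial `a_0 + a_1 z + ... + a_d z^d`. -/
def poly {d : ℕ} (a : Fin (d + 1) → ℂ) : ℂ[X] :=
  ∑ k : Fin (d + 1), Polynomial.C (a k) * Polynomial.X ^ (k : ℕ)

/-- Coefficient vectors `(a_0, ..., a_d, b_0, ..., b_d)` of fractions of degree exactly `d`: the
polynomials `∑ a_k z^k` and `∑ b_k z^k` are coprime and at least one of them has degree `d`.
(For `d ≥ 1` this is the complement in `ℂ^(2d+2)` of the zero locus of the resultant of two
polynomials of formal degree `d`.) It carries the subspace topology. -/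
abbrev Coeffs (d : ℕ) : Type :=
  {p : (Fin (d + 1) → ℂ) × (Fin (d + 1) → ℂ) //
    IsCoprime (poly p.1) (poly p.2) ∧
      max (poly p.1).natDegree (poly p.2).natDegree = d}

/-- The self-map of the Riemann sphere `OnePoint ℂ` given by
`z ↦ (∑ a_k z^k) / (∑ b_k z^k)`; its value at infinity is `a_d / b_d`. -/
def Coeffs.toFun {d : ℕ} (p : Coeffs d) (x : OnePoint ℂ) : OnePoint ℂ :=
  x.elim
    (if p.1.2 (Fin.last d) = 0 then OnePoint.infty
      else ((p.1.1 (Fin.last d) / p.1.2 (Fin.last d) : ℂ) : OnePoint ℂ))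
    (fun z => if (poly p.1.2).eval z = 0 then OnePoint.infty
      else (((poly p.1.1).eval z / (poly p.1.2).eval z : ℂ) : OnePoint ℂ))

/-- Two coefficient vectors are related if they are proportional. -/
instance proportional (d : ℕ) : Setoid (Coeffs d) where
  r p q := ∃ c : ℂ, c ≠ 0 ∧ q.1 = c • p.1
  iseqv :=
    { refl := fun p => ⟨1, one_ne_zero, by simp⟩
      symm := by
        rintro p q ⟨c, hc, h⟩
        exact ⟨c⁻¹, inv_ne_zero hc, by rw [h, smul_smul, inv_mul_cancel₀ hc, one_smul]⟩
      trans := by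
        rintro p q r ⟨c, hc, h⟩ ⟨e, he, h'⟩
        exact ⟨e * c, mul_ne_zero he hc, by rw [h', h, smul_smul]⟩ }

/-- The space `Rat_d` of complex rational maps of degree `d`, as the open subset of the projective
space `P^(2d+1)` of classes `[a_0 : ... : a_d : b_0 : ... : b_d]`. -/
def Rat (d : ℕ) : Type := Quotient (proportional d)

instance (d : ℕ) : TopologicalSpace (Rat d) :=
  inferInstanceAs (TopologicalSpace (Quotient (proportional d)))

theorem poly_smul {d : ℕ} (c : ℂ) (a : Fin (d + 1) → ℂ) :
    poly (c • a) = Polynomial.C c * poly a := by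
  simp [poly, Finset.mul_sum, mul_assoc]

theorem toFun_congr {d : ℕ} (p q : Coeffs d) (h : p ≈ q) : p.toFun = q.toFun := by
  obtain ⟨c, hc, h⟩ := h
  funext x
  cases x with
  | infty =>
    simp [Coeffs.toFun, h, hc, mul_div_mul_left]
  | coe z =>
    simp [Coeffs.toFun, h, poly_smul, hc, mul_div_mul_left]

/-- The self-map of the Riemann sphere defined by an element of `Rat_d`. -/
def Rat.toFun {d : ℕ} (φ : Rat d) : OnePoint ℂ → OnePoint ℂ :=
  Quotient.lift Coeffs.toFun toFun_congr φ

/-- Equivalence of rational maps: `ψ = T ∘ φ ∘ T⁻¹` for some Möbius transformation `T`. Möbius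
transformations are given by the action of `GL₂(ℂ)` on the Riemann sphere, which has the same
image as that of `PSL₂(ℂ)`. -/
def Conjugate {d : ℕ} (φ ψ : Rat d) : Prop :=
  ∃ T : GL (Fin 2) ℂ, ∀ x : OnePoint ℂ, ψ.toFun x = T • φ.toFun (T⁻¹ • x)

instance conjugacy (d : ℕ) : Setoid (Rat d) where
  r := Conjugate
  iseqv :=
    { refl := fun φ => ⟨1, by simp⟩
      symm := by
        rintro φ ψ ⟨T, h⟩
        exact ⟨T⁻¹, fun x => by simp [h]⟩
      trans := by
        rintro φ ψ χ ⟨T, h⟩ ⟨S, h'⟩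
        exact ⟨S * T, fun x => by simp [h, h', mul_smul]⟩ }

/-- The moduli space `M_d = Rat_d / PSL₂(ℂ)`. -/
def Moduli (d : ℕ) : Type := Quotient (conjugacy d)

instance (d : ℕ) : TopologicalSpace (Moduli d) :=
  inferInstanceAs (TopologicalSpace (Quotient (conjugacy d)))

/-- The class of a rational map in moduli space. -/
def Rat.cls {d : ℕ} (φ : Rat d) : Moduli d := Quotient.mk (conjugacy d) φ

/-- The extended Möbius transformation `T ∘ J`, where `J` is complex conjugation. -/
def antiMobius (T : GL (Fin 2) ℂ) (x : OnePoint ℂ) : OnePoint ℂ :=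
  T • OnePoint.map (starRingEnd ℂ) x

/-- `φ` admits an antiholomorphic automorphism, i.e. commutes with some extended Möbius
transformation. -/
def AdmitsAntiholomorphic {d : ℕ} (φ : Rat d) : Prop :=
  ∃ T : GL (Fin 2) ℂ, ∀ x : OnePoint ℂ, antiMobius T (φ.toFun x) = φ.toFun (antiMobius T x)

/-- All coefficients of `φ` are real, in some choice of homogeneous coordinates. -/
def HasRealCoeffs {d : ℕ} (φ : Rat d) : Prop :=
  ∃ p : Coeffs d, Quotient.mk (proportional d) p = φ ∧
    (∀ k, (p.1.1 k).im = 0) ∧ ∀ k, (p.1.2 k).im = 0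

/-- `φ` is real: it is equivalent to a rational map with real coefficients. -/
def IsReal {d : ℕ} (φ : Rat d) : Prop :=
  ∃ ψ : Rat d, Conjugate φ ψ ∧ HasRealCoeffs ψ

/-- `φ` is pseudo-real: it admits antiholomorphic automorphisms but is not real. -/
def IsPseudoReal {d : ℕ} (φ : Rat d) : Prop :=
  AdmitsAntiholomorphic φ ∧ ¬ IsReal φ

/-- The locus in moduli space of the classes of pseudo-real rational maps. -/
def pseudoRealLocus (d : ℕ) : Set (Moduli d) :=
  {c | ∃ φ : Rat d, IsPseudoReal φ ∧ φ.cls = c}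

end RationalMap

end

/-! The square of an extended Möbius map `z ↦ T (conj z)` has matrix `M = T * conj T`. A Möbius map
commuting with `φ` of degree at least two has finite order in `PGL₂`. Taking powers of the extended
symmetry therefore yields either a Möbius involution commuting with `φ`, or an antiholomorphic
involution, for which `T * conj T` is a nonzero real scalar `r`. If `r > 0`, the symmetry is a
reflection and Hilbert 90 makes `φ` real. So the classes of maps with an antipodal symmetry (`r <
0`) and the classes of maps with a Möbius involution together cover the pseudo-real locus.

Both sets are closed in moduli space. Symmetries rescaled to unit norm lie in a compact set, and in
degree at least two a limit of symmetries cannot degenerate to a singular matrix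
(`isClosed_setOf_exists_intertwines`).

Their intersection contains only real maps. Composing an antipodal symmetry with an involution gives
an extended symmetry whose `M` has positive eigenvalues up to scale; finite order makes `M` a
positive scalar, so the composite is a reflection (`isReal_of_hasInvolution_of_hasAntiInvolution`).

Each set meets the locus. The map `i((z - 1)/(z + 1))^d` commutes with the antipodal map because `d`
is odd. For the involution `z ↦ -z`, explicit fields on `ℂ²` are used whose divergence is a multiple
of `(xy)^n`, where `d = 2n + 1`. Divergence is covariant, so every symmetry preserves the pair of
axes, and the few remaining candidates are excluded by comparing coefficients. -/

noncomputable section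

namespace RationalMap

open Matrix

/-! ### Homogeneous forms and lifts to `ℂ²` -/

/-- The homogeneous form `∑ a_k x^k y^(d-k)`. -/
def form {d : ℕ} (a : Fin (d + 1) → ℂ) (v : Fin 2 → ℂ) : ℂ :=
  ∑ k : Fin (d + 1), a k * v 0 ^ (k : ℕ) * v 1 ^ (d - k)

/-- The homogeneous lift to `ℂ²` of the fraction with the given coefficients. -/
def lift {d : ℕ} (p : (Fin (d + 1) → ℂ) × (Fin (d + 1) → ℂ)) (v : Fin 2 → ℂ) : Fin 2 → ℂ :=
  ![form p.1 v, form p.2 v]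

/-- The point of the Riemann sphere with the given homogeneous coordinates. -/
def toSphere (v : Fin 2 → ℂ) : OnePoint ℂ :=
  if v 1 = 0 then OnePoint.infty else ((v 0 / v 1 : ℂ) : OnePoint ℂ)

theorem poly_coeff {d : ℕ} (a : Fin (d + 1) → ℂ) (k : Fin (d + 1)) :
    (poly a).coeff (k : ℕ) = a k := by
  simp only [poly, Polynomial.finsetSum_coeff, Polynomial.coeff_C_mul, Polynomial.coeff_X_pow]
  rw [Finset.sum_eq_single k]
  · simp
  · intro b _ hb
    have : (k : ℕ) ≠ b := fun h => hb (Fin.ext h.symm)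
    simp [this]
  · simp

theorem natDegree_poly_le {d : ℕ} (a : Fin (d + 1) → ℂ) : (poly a).natDegree ≤ d := by
  refine Polynomial.natDegree_sum_le_of_forall_le _ _ fun k _ => ?_
  exact (Polynomial.natDegree_C_mul_X_pow_le _ _).trans (Nat.lt_succ_iff.1 k.2)

theorem poly_injective {d : ℕ} : Function.Injective (poly (d := d)) := fun a b h => by
  funext k
  rw [← poly_coeff a, h, poly_coeff]

theorem natDegree_poly_eq {d : ℕ} {a : Fin (d + 1) → ℂ} (h : a (Fin.last d) ≠ 0) :
    (poly a).natDegree = d := by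
  refine le_antisymm (natDegree_poly_le a) (Polynomial.le_natDegree_of_ne_zero ?_)
  have := poly_coeff a (Fin.last d)
  rw [Fin.val_last] at this
  rwa [this]

theorem natDegree_poly_lt {d : ℕ} (hd : 1 ≤ d) {a : Fin (d + 1) → ℂ} (h : a (Fin.last d) = 0) :
    (poly a).natDegree < d := by
  refine lt_of_le_of_ne (natDegree_poly_le a) fun he => ?_
  have := poly_coeff a (Fin.last d)
  rw [Fin.val_last, h] at this
  have h0 : poly a = 0 := by
    rw [← Polynomial.leadingCoeff_eq_zero, Polynomial.leadingCoeff, he, this]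
  rw [h0, Polynomial.natDegree_zero] at he
  omega

theorem form_of_ne {d : ℕ} (a : Fin (d + 1) → ℂ) {v : Fin 2 → ℂ} (hv : v 1 ≠ 0) :
    form a v = v 1 ^ d * (poly a).eval (v 0 / v 1) := by
  simp only [form, poly, Polynomial.eval_finsetSum, Polynomial.eval_mul, Polynomial.eval_C,
    Polynomial.eval_pow, Polynomial.eval_X, Finset.mul_sum]
  refine Finset.sum_congr rfl fun k _ => ?_
  have hk : (k : ℕ) ≤ d := Nat.lt_succ_iff.1 k.2
  have : v 1 ^ d = v 1 ^ (k : ℕ) * v 1 ^ (d - k) := by rw [← pow_add]; congr 1; omega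
  rw [div_pow, this]
  field_simp

theorem form_of_eq {d : ℕ} (a : Fin (d + 1) → ℂ) {v : Fin 2 → ℂ} (hv : v 1 = 0) :
    form a v = a (Fin.last d) * v 0 ^ d := by
  rw [form, Finset.sum_eq_single (Fin.last d)]
  · simp
  · intro k _ hk
    have : (k : ℕ) < d := by
      have := Fin.val_lt_last hk
      simpa using this
    rw [hv, zero_pow (by omega), mul_zero]
  · simp

theorem form_injective {d : ℕ} : Function.Injective (form (d := d)) := fun a b h => by
  apply poly_injective
  refine Polynomial.funext fun z => ?_
  have := congrFun h ![z, 1]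
  rw [form_of_ne _ (by simp), form_of_ne _ (by simp)] at this
  simpa using this

theorem form_smul_vec {d : ℕ} (a : Fin (d + 1) → ℂ) (c : ℂ) (v : Fin 2 → ℂ) :
    form a (c • v) = c ^ d * form a v := by
  rw [form, form, Finset.mul_sum]
  refine Finset.sum_congr rfl fun k _ => ?_
  have hk : (k : ℕ) ≤ d := Nat.lt_succ_iff.1 k.2
  have : c ^ d = c ^ (k : ℕ) * c ^ (d - k) := by rw [← pow_add]; congr 1; omega
  simp only [Pi.smul_apply, smul_eq_mul, mul_pow, this]
  ring

theorem form_smul {d : ℕ} (a : Fin (d + 1) → ℂ) (c : ℂ) (v : Fin 2 → ℂ) :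
    form (c • a) v = c * form a v := by
  simp only [form, Finset.mul_sum, Pi.smul_apply, smul_eq_mul, mul_assoc]

theorem form_add {d : ℕ} (a b : Fin (d + 1) → ℂ) (v : Fin 2 → ℂ) :
    form (a + b) v = form a v + form b v := by
  simp only [form, ← Finset.sum_add_distrib, Pi.add_apply, add_mul]

theorem form_star {d : ℕ} (a : Fin (d + 1) → ℂ) (v : Fin 2 → ℂ) :
    form (star a) (star v) = star (form a v) := by
  simp [form]

theorem lift_smul_vec {d : ℕ} (p : (Fin (d + 1) → ℂ) × (Fin (d + 1) → ℂ)) (c : ℂ)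
    (v : Fin 2 → ℂ) : lift p (c • v) = c ^ d • lift p v := by
  simp [lift, form_smul_vec]

theorem lift_smul {d : ℕ} (p : (Fin (d + 1) → ℂ) × (Fin (d + 1) → ℂ)) (c : ℂ)
    (v : Fin 2 → ℂ) : lift (c • p) v = c • lift p v := by
  simp [lift, form_smul]

theorem lift_star {d : ℕ} (p : (Fin (d + 1) → ℂ) × (Fin (d + 1) → ℂ)) (v : Fin 2 → ℂ) :
    lift (star p) (star v) = star (lift p v) := by
  ext i; fin_cases i <;> simp [lift, form_star]

theorem lift_injective {d : ℕ} : Function.Injective (lift (d := d)) := fun p q h => by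
  refine Prod.ext (form_injective (funext fun v => ?_)) (form_injective (funext fun v => ?_))
  · exact congrFun (congrFun h v) 0
  · exact congrFun (congrFun h v) 1

theorem continuous_lift {d : ℕ} :
    Continuous fun x : ((Fin (d + 1) → ℂ) × (Fin (d + 1) → ℂ)) × (Fin 2 → ℂ) =>
      lift x.1 x.2 := by
  refine continuous_pi fun i => ?_
  fin_cases i <;> simp only [lift, form] <;> simp <;> fun_prop

/-- Coprimality excludes common zeros in the affine chart, and the exact degree excludes one at
infinity. -/
theorem lift_ne_zero {d : ℕ} (hd : 1 ≤ d) (p : Coeffs d) {v : Fin 2 → ℂ} (hv : v ≠ 0) :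
    lift p.1 v ≠ 0 := by
  intro h
  have h0 : form p.1.1 v = 0 := congrFun h 0
  have h1 : form p.1.2 v = 0 := congrFun h 1
  by_cases hv1 : v 1 = 0
  · have hv0 : v 0 ≠ 0 := fun hv0 => hv (by ext i; fin_cases i <;> assumption)
    rw [form_of_eq _ hv1] at h0 h1
    have h0 := natDegree_poly_lt hd ((mul_eq_zero.1 h0).resolve_right (pow_ne_zero _ hv0))
    have h1 := natDegree_poly_lt hd ((mul_eq_zero.1 h1).resolve_right (pow_ne_zero _ hv0))
    have := p.2.2
    omega
  · rw [form_of_ne _ hv1] at h0 h1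
    have h0 := (mul_eq_zero.1 h0).resolve_left (pow_ne_zero _ hv1)
    have h1 := (mul_eq_zero.1 h1).resolve_left (pow_ne_zero _ hv1)
    obtain ⟨u, w, huw⟩ := p.2.1
    have := congrArg (Polynomial.eval (v 0 / v 1)) huw
    simp [h0, h1] at this

theorem isCoprime_and_max_natDegree_of_lift_ne_zero {d : ℕ}
    {p : (Fin (d + 1) → ℂ) × (Fin (d + 1) → ℂ)} (h : ∀ v, v ≠ 0 → lift p v ≠ 0) :
    IsCoprime (poly p.1) (poly p.2) ∧
      max (poly p.1).natDegree (poly p.2).natDegree = d := by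
  constructor
  · rw [Polynomial.isCoprime_iff_aeval_ne_zero_of_isAlgClosed ℂ ℂ]
    intro z
    by_contra hz
    push Not at hz
    refine h ![z, 1] (by simp) ?_
    simp only [Polynomial.coe_aeval_eq_eval] at hz
    simp [lift, form_of_ne, hz]
  · have h0 : p.1 (Fin.last d) ≠ 0 ∨ p.2 (Fin.last d) ≠ 0 := by
      by_contra hz
      push Not at hz
      exact h ![1, 0] (by simp) (by simp [lift, form_of_eq, hz])
    have h1 := natDegree_poly_le p.1
    have h2 := natDegree_poly_le p.2
    rcases h0 with h0 | h0
    · rw [natDegree_poly_eq h0]; omega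
    · rw [natDegree_poly_eq h0]; omega

/-- Build an element of `Coeffs d` from a homogeneous lift without zeros. -/
def Coeffs.ofLift {d : ℕ} (p : (Fin (d + 1) → ℂ) × (Fin (d + 1) → ℂ))
    (h : ∀ v, v ≠ 0 → lift p v ≠ 0) : Coeffs d :=
  ⟨p, isCoprime_and_max_natDegree_of_lift_ne_zero h⟩

/-! ### The Riemann sphere in homogeneous coordinates -/

theorem exists_toSphere (x : OnePoint ℂ) : ∃ v, v ≠ 0 ∧ toSphere v = x := by
  cases x with
  | infty => exact ⟨![1, 0], by simp, by simp [toSphere]⟩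
  | coe z => exact ⟨![z, 1], by simp, by simp [toSphere]⟩

theorem eq_smul_of_toSphere_eq {v w : Fin 2 → ℂ} (hv : v ≠ 0) (hw : w ≠ 0)
    (h : toSphere v = toSphere w) : ∃ c : ℂ, c ≠ 0 ∧ w = c • v := by
  unfold toSphere at h
  split_ifs at h with h1 h2 h2
  · have hv0 : v 0 ≠ 0 := fun hv0 => hv (by ext i; fin_cases i <;> assumption)
    have hw0 : w 0 ≠ 0 := fun hv0 => hw (by ext i; fin_cases i <;> assumption)
    refine ⟨w 0 / v 0, div_ne_zero hw0 hv0, ?_⟩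
    ext i; fin_cases i
    · simp [hv0]
    · simp [h1, h2]
  · simp at h
  · simp at h
  · refine ⟨w 1 / v 1, div_ne_zero h2 h1, ?_⟩
    rw [OnePoint.coe_eq_coe] at h
    field_simp at h
    ext i; fin_cases i
    · simp; field_simp; linear_combination -h
    · simp [h1]

theorem toSphere_smul {c : ℂ} (hc : c ≠ 0) (v : Fin 2 → ℂ) : toSphere (c • v) = toSphere v := by
  simp [toSphere, hc, mul_div_mul_left]

theorem gl_smul_toSphere (T : GL (Fin 2) ℂ) {v : Fin 2 → ℂ} (hv : v ≠ 0) :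
    T • toSphere v = toSphere (T.1 *ᵥ v) := by
  unfold toSphere
  split_ifs with h1 h2 h2
  · have hv0 : v 0 ≠ 0 := fun hv0 => hv (by ext i; fin_cases i <;> assumption)
    simp [h1, hv0] at h2
    simp [OnePoint.smul_infty_eq_ite, h2]
  · have hv0 : v 0 ≠ 0 := fun hv0 => hv (by ext i; fin_cases i <;> assumption)
    simp [h1, hv0] at h2
    simp [OnePoint.smul_infty_eq_ite, h2, h1, hv0, mul_div_mul_right]
  · simp at h2
    rw [OnePoint.smul_some_eq_ite, if_pos]
    field_simp
    linear_combination h2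
  · simp at h2
    have : T.1 1 0 * (v 0 / v 1) + T.1 1 1 ≠ 0 := by
      field_simp
      exact div_ne_zero (by convert h2 using 1; ring) h1
    rw [OnePoint.smul_some_eq_ite, if_neg this]
    simp only [mulVec_fin_two, cons_val_zero, cons_val_one, OnePoint.coe_eq_coe]
    rw [div_eq_div_iff this h2]
    field_simp

theorem map_conj_toSphere (v : Fin 2 → ℂ) :
    OnePoint.map (starRingEnd ℂ) (toSphere v) = toSphere (star v) := by
  simp only [toSphere, apply_ite (OnePoint.map (starRingEnd ℂ))]
  simp

theorem Coeffs.toFun_toSphere {d : ℕ} (p : Coeffs d) {v : Fin 2 → ℂ} (hv : v ≠ 0) :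
    p.toFun (toSphere v) = toSphere (lift p.1 v) := by
  by_cases h : v 1 = 0
  · have hv0 : v 0 ≠ 0 := fun hv0 => hv (by ext i; fin_cases i <;> assumption)
    simp [toSphere, h, Coeffs.toFun, lift, form_of_eq, hv0, mul_div_mul_right]
  · simp [toSphere, h, Coeffs.toFun, lift, form_of_ne, mul_div_mul_left]

/-! ### Linear substitutions and uniqueness of the lift -/

theorem exists_form_eq_linear_mul {d : ℕ} (b : Fin (d + 1) → ℂ) (α β : ℂ) :
    ∃ b' : Fin (d + 1 + 1) → ℂ, ∀ v, form b' v = (α * v 0 + β * v 1) * form b v := by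
  refine ⟨α • (Fin.cons 0 b : Fin (d + 1 + 1) → ℂ) + β • (Fin.snoc b 0 : Fin (d + 1 + 1) → ℂ),
    fun v => ?_⟩
  have h1 : form (Fin.cons 0 b : Fin (d + 1 + 1) → ℂ) v = v 0 * form b v := by
    rw [form, Fin.sum_univ_succ, form, Finset.mul_sum]
    simp only [Fin.cons_zero, Fin.cons_succ, Fin.val_succ, zero_mul, zero_add,
      Nat.add_sub_add_right, pow_succ]
    exact Finset.sum_congr rfl fun k _ => by ring
  have h2 : form (Fin.snoc b 0 : Fin (d + 1 + 1) → ℂ) v = v 1 * form b v := by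
    rw [form, Fin.sum_univ_castSucc, form, Finset.mul_sum]
    simp only [Fin.snoc_castSucc, Fin.snoc_last, zero_mul, add_zero, Fin.val_castSucc]
    refine Finset.sum_congr rfl fun k _ => ?_
    have hk : (k : ℕ) ≤ d := Nat.lt_succ_iff.1 k.2
    rw [Nat.succ_sub hk, pow_succ]
    ring
  rw [form_add, form_smul, form_smul, h1, h2]
  ring

theorem exists_form_eq_pow_mul_pow (α β γ δ : ℂ) : ∀ d k m : ℕ, k + m = d →
    ∃ b : Fin (d + 1) → ℂ, ∀ v, form b v = (α * v 0 + β * v 1) ^ k * (γ * v 0 + δ * v 1) ^ m := by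
  intro d
  induction d with
  | zero =>
    intro k m h
    obtain ⟨rfl, rfl⟩ : k = 0 ∧ m = 0 := by omega
    exact ⟨fun _ => 1, fun v => by simp [form]⟩
  | succ d ih =>
    intro k m h
    cases k with
    | zero =>
      obtain ⟨b, hb⟩ := ih 0 d (by omega)
      obtain ⟨b', hb'⟩ := exists_form_eq_linear_mul b γ δ
      obtain rfl : m = d + 1 := by omega
      exact ⟨b', fun v => by rw [hb', hb]; ring⟩
    | succ k =>
      obtain ⟨b, hb⟩ := ih k m (by omega)
      obtain ⟨b', hb'⟩ := exists_form_eq_linear_mul b α β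
      exact ⟨b', fun v => by rw [hb', hb]; ring⟩

theorem exists_form_comp {d : ℕ} (a : Fin (d + 1) → ℂ) (T : Matrix (Fin 2) (Fin 2) ℂ) :
    ∃ b : Fin (d + 1) → ℂ, ∀ v, form b v = form a (T *ᵥ v) := by
  have h : ∀ k : Fin (d + 1), ∃ b : Fin (d + 1) → ℂ, ∀ v, form b v =
      (T 0 0 * v 0 + T 0 1 * v 1) ^ (k : ℕ) * (T 1 0 * v 0 + T 1 1 * v 1) ^ (d - k) := fun k =>
    exists_form_eq_pow_mul_pow _ _ _ _ d k (d - k) (by have := k.2; omega)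
  choose b hb using h
  refine ⟨∑ k, a k • b k, fun v => ?_⟩
  have hs : ∀ s : Finset (Fin (d + 1)), form (∑ k ∈ s, a k • b k) v = ∑ k ∈ s, a k * form (b k) v := by
    classical
    intro s
    induction s using Finset.induction_on with
    | empty => simp [form]
    | insert k s hk ih => rw [Finset.sum_insert hk, Finset.sum_insert hk, form_add, form_smul, ih]
  rw [hs, form]
  simp only [hb, mulVec_fin_two, cons_val_zero, cons_val_one, mul_assoc]

theorem exists_lift_comp {d : ℕ} (p : (Fin (d + 1) → ℂ) × (Fin (d + 1) → ℂ))
    (S T : Matrix (Fin 2) (Fin 2) ℂ) :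
    ∃ q : (Fin (d + 1) → ℂ) × (Fin (d + 1) → ℂ), ∀ v, lift q v = S *ᵥ lift p (T *ᵥ v) := by
  obtain ⟨a, ha⟩ := exists_form_comp p.1 T
  obtain ⟨b, hb⟩ := exists_form_comp p.2 T
  refine ⟨(S 0 0 • a + S 0 1 • b, S 1 0 • a + S 1 1 • b), fun v => ?_⟩
  simp only [lift, form_add, form_smul, ha, hb]
  rw [mulVec_fin_two S]
  simp

theorem GL_mulVec_ne_zero (T : GL (Fin 2) ℂ) {v : Fin 2 → ℂ} (hv : v ≠ 0) : T.1 *ᵥ v ≠ 0 := by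
  intro h
  apply hv
  have := congrArg (T⁻¹.1 *ᵥ ·) h
  simpa [-mulVec_fin_two, -coe_units_inv, mulVec_mulVec, ← Units.val_mul] using this

theorem exists_conjugate_coeffs {d : ℕ} (hd : 1 ≤ d) (p : Coeffs d) (T : GL (Fin 2) ℂ) :
    ∃ r : Coeffs d, (∀ v, lift r.1 v = T⁻¹.1 *ᵥ lift p.1 (T.1 *ᵥ v)) ∧
      ∀ x, r.toFun x = T⁻¹ • p.toFun (T • x) := by
  obtain ⟨q, hq⟩ := exists_lift_comp p.1 T⁻¹.1 T.1
  refine ⟨Coeffs.ofLift q fun v hv => ?_, hq, fun x => ?_⟩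
  · rw [hq]
    exact GL_mulVec_ne_zero _ (lift_ne_zero hd _ (GL_mulVec_ne_zero _ hv))
  · obtain ⟨v, hv, rfl⟩ := exists_toSphere x
    have hT := GL_mulVec_ne_zero T hv
    rw [Coeffs.toFun_toSphere _ hv, gl_smul_toSphere _ hv, Coeffs.toFun_toSphere _ hT,
      gl_smul_toSphere _ (lift_ne_zero hd _ hT), ← hq]
    rfl

/-- Equal values give equal cross products of numerators and denominators. Coprimality of `p` makes
`q` a common polynomial multiple of `p`, and coprimality of `q` makes the factor a unit. -/
theorem exists_smul_eq_of_toFun_eq {d : ℕ} (hd : 1 ≤ d) (p q : Coeffs d) (h : p.toFun = q.toFun) :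
    ∃ c : ℂ, c ≠ 0 ∧ q.1 = c • p.1 := by
  have hpoly : poly p.1.1 * poly q.1.2 = poly q.1.1 * poly p.1.2 := by
    refine Polynomial.funext fun z => ?_
    have hz : (![z, 1] : Fin 2 → ℂ) ≠ 0 := by simp
    have h' := congrFun h (toSphere ![z, 1])
    rw [Coeffs.toFun_toSphere _ hz, Coeffs.toFun_toSphere _ hz] at h'
    obtain ⟨c, -, hc⟩ := eq_smul_of_toSphere_eq (lift_ne_zero hd _ hz) (lift_ne_zero hd _ hz) h'
    have h0 := congrFun hc 0
    have h1 := congrFun hc 1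
    simp [lift, form_of_ne] at h0 h1
    simp only [Polynomial.eval_mul, h0, h1]
    ring
  obtain ⟨g, hg⟩ : poly p.1.1 ∣ poly q.1.1 :=
    p.2.1.dvd_of_dvd_mul_right (Dvd.intro _ hpoly)
  obtain ⟨g', hg'⟩ : poly p.1.2 ∣ poly q.1.2 :=
    p.2.1.symm.dvd_of_dvd_mul_left (Dvd.intro_left _ hpoly.symm)
  have hgg : poly p.1.1 * poly p.1.2 * (g' - g) = 0 := by
    rw [hg, hg'] at hpoly
    linear_combination hpoly
  have key : ∃ g : ℂ[X], poly q.1.1 = poly p.1.1 * g ∧ poly q.1.2 = poly p.1.2 * g := by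
    rcases mul_eq_zero.1 hgg with h0 | h0
    · rcases mul_eq_zero.1 h0 with h0 | h0
      · exact ⟨g', by rw [hg, h0, zero_mul, zero_mul], hg'⟩
      · exact ⟨g, hg, by rw [hg', h0, zero_mul, zero_mul]⟩
    · exact ⟨g, hg, by rw [hg', sub_eq_zero.1 h0]⟩
  obtain ⟨g, h1, h2⟩ := key
  have hu : IsUnit g := by
    have := q.2.1
    rw [h1, h2] at this
    exact this.isUnit_of_dvd' (dvd_mul_left _ _) (dvd_mul_left _ _)
  obtain ⟨c, hc, rfl⟩ := Polynomial.isUnit_iff.1 hu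
  refine ⟨c, hc.ne_zero, Prod.ext (poly_injective ?_) (poly_injective ?_)⟩
  · rw [Prod.smul_fst, poly_smul, h1, mul_comm]
  · rw [Prod.smul_snd, poly_smul, h2, mul_comm]

/-! ### Symmetries as intertwining matrices -/

/-- `F ∘ T` and `T ∘ G` agree up to a nonzero scalar. -/
def Intertwines (F G : (Fin 2 → ℂ) → Fin 2 → ℂ) (T : Matrix (Fin 2) (Fin 2) ℂ) : Prop :=
  ∃ c : ℂ, c ≠ 0 ∧ ∀ v, F (T *ᵥ v) = c • T *ᵥ G v

theorem smul_toFun_eq_iff {d : ℕ} (hd : 1 ≤ d) (p q : Coeffs d) (T : GL (Fin 2) ℂ) :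
    (∀ x, T • q.toFun x = p.toFun (T • x)) ↔ Intertwines (lift p.1) (lift q.1) T.1 := by
  constructor
  · intro h
    obtain ⟨r, hr, hr'⟩ := exists_conjugate_coeffs hd p T
    obtain ⟨c, hc, hcr⟩ := exists_smul_eq_of_toFun_eq hd q r (by
      funext x
      rw [hr', ← h, inv_smul_smul])
    refine ⟨c, hc, fun v => ?_⟩
    have := hr v
    rw [hcr, lift_smul] at this
    rw [← mulVec_smul, this, mulVec_mulVec, ← Units.val_mul, mul_inv_cancel, Units.val_one,
      one_mulVec]
  · rintro ⟨c, hc, h⟩ x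
    obtain ⟨v, hv, rfl⟩ := exists_toSphere x
    have hT := GL_mulVec_ne_zero T hv
    rw [Coeffs.toFun_toSphere _ hv, gl_smul_toSphere _ hv, Coeffs.toFun_toSphere _ hT,
      gl_smul_toSphere _ (lift_ne_zero hd _ hv), h, toSphere_smul hc]

/-- The complex conjugate of a rational map. -/
def Coeffs.conj {d : ℕ} (hd : 1 ≤ d) (p : Coeffs d) : Coeffs d :=
  Coeffs.ofLift (star p.1) fun v hv h => by
    refine lift_ne_zero hd p (star_ne_zero.2 hv) ?_
    rw [← star_eq_zero, ← lift_star, star_star, h]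

theorem map_conj_toFun {d : ℕ} (hd : 1 ≤ d) (p : Coeffs d) (x : OnePoint ℂ) :
    OnePoint.map (starRingEnd ℂ) (p.toFun x) =
      (p.conj hd).toFun (OnePoint.map (starRingEnd ℂ) x) := by
  obtain ⟨v, hv, rfl⟩ := exists_toSphere x
  rw [Coeffs.toFun_toSphere _ hv, map_conj_toSphere, map_conj_toSphere,
    Coeffs.toFun_toSphere _ (star_ne_zero.2 hv), ← lift_star]
  rfl

theorem map_conj_map_conj (x : OnePoint ℂ) :
    OnePoint.map (starRingEnd ℂ) (OnePoint.map (starRingEnd ℂ) x) = x := by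
  cases x <;> simp

theorem antiMobius_commute_iff {d : ℕ} (hd : 1 ≤ d) (p : Coeffs d) (T : GL (Fin 2) ℂ) :
    (∀ x, antiMobius T (p.toFun x) = p.toFun (antiMobius T x)) ↔
      Intertwines (lift p.1) (lift (star p.1)) T.1 := by
  rw [show star p.1 = (p.conj hd).1 from rfl, ← smul_toFun_eq_iff hd]
  simp only [antiMobius, map_conj_toFun hd]
  exact ⟨fun h x => by simpa [map_conj_map_conj] using h (OnePoint.map (starRingEnd ℂ) x),
    fun h x => h _⟩

/-- The entrywise complex conjugate of an invertible matrix. -/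
abbrev conjGL (T : GL (Fin 2) ℂ) : GL (Fin 2) ℂ := GeneralLinearGroup.map (starRingEnd ℂ) T

theorem antiMobius_smul (S T : GL (Fin 2) ℂ) (x : OnePoint ℂ) :
    antiMobius T (S • x) = (T * conjGL S) • OnePoint.map (starRingEnd ℂ) x := by
  rw [antiMobius, OnePoint.map_smul, mul_smul]

/-! ### Involutions and their conjugation invariance -/

/-- `φ` commutes with an antiholomorphic involution whose matrix `T` satisfies `T * conj T = r`. -/
def HasAntiInvolution {d : ℕ} (φ : Rat d) (r : ℝ) : Prop :=
  ∃ T : GL (Fin 2) ℂ, T.1 * (conjGL T).1 = (r : ℂ) • (1 : Matrix (Fin 2) (Fin 2) ℂ) ∧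
    ∀ x, antiMobius T (φ.toFun x) = φ.toFun (antiMobius T x)

/-- `φ` commutes with a Möbius involution. -/
def HasInvolution {d : ℕ} (φ : Rat d) : Prop :=
  ∃ A : GL (Fin 2) ℂ, A.1.trace = 0 ∧ ∀ x, A • φ.toFun x = φ.toFun (A • x)

theorem conjGL_conjGL (S : GL (Fin 2) ℂ) : conjGL (conjGL S) = S := by
  ext i j
  simp

theorem HasAntiInvolution.conjugate {d : ℕ} {φ ψ : Rat d} {r : ℝ} (h : HasAntiInvolution φ r)
    (hc : Conjugate φ ψ) : HasAntiInvolution ψ r := by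
  obtain ⟨T, hT, hφ⟩ := h
  obtain ⟨S, hS⟩ := hc
  refine ⟨S * T * (conjGL S)⁻¹, ?_, fun x => ?_⟩
  · have : conjGL (S * T * (conjGL S)⁻¹) = conjGL S * conjGL T * S⁻¹ := by
      rw [conjGL, map_mul, map_mul, map_inv]
      exact congrArg (fun X => _ * X⁻¹) (conjGL_conjGL S)
    rw [this]
    calc (S * T * (conjGL S)⁻¹).1 * (conjGL S * conjGL T * S⁻¹).1
        = S.1 * (T.1 * (conjGL T).1) * S⁻¹.1 := by
          simp only [← Units.val_mul]; group
      _ = _ := by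
          rw [hT, mul_smul_comm, smul_mul_assoc, mul_one, ← Units.val_mul, mul_inv_cancel]; rfl
  · rw [hS x, antiMobius_smul, hS]
    have h1 : S⁻¹ • antiMobius (S * T * (conjGL S)⁻¹) x = antiMobius T (S⁻¹ • x) := by
      rw [antiMobius_smul, antiMobius, smul_smul, conjGL, conjGL, map_inv]
      congr 1
      group
    rw [h1, ← hφ, antiMobius, smul_smul]
    congr 1
    group

theorem HasInvolution.conjugate {d : ℕ} {φ ψ : Rat d} (h : HasInvolution φ)
    (hc : Conjugate φ ψ) : HasInvolution ψ := by
  obtain ⟨A, hA, hφ⟩ := h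
  obtain ⟨S, hS⟩ := hc
  refine ⟨S * A * S⁻¹, ?_, fun x => ?_⟩
  · rw [Units.val_mul, Matrix.trace_mul_comm, ← Units.val_mul, ← mul_assoc, inv_mul_cancel, one_mul,
      hA]
  · rw [hS x, hS, smul_smul, smul_smul, show S⁻¹ * (S * A * S⁻¹) = A * S⁻¹ by group, mul_smul A,
      ← hφ, smul_smul]
    congr 1
    group

/-! ### Closedness of the symmetry loci -/

/-- A closed condition equivalent to `Intertwines (lift p) (lift q) T` for nonzero `T`. -/
def Adjoint {d : ℕ} (p q : (Fin (d + 1) → ℂ) × (Fin (d + 1) → ℂ))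
    (T : Matrix (Fin 2) (Fin 2) ℂ) : Prop :=
  ∀ w u i j, lift p (T *ᵥ w) i * lift q (T.adjugate *ᵥ u) j =
    T.det ^ (d - 1) * (T *ᵥ lift q w) i * (T.adjugate *ᵥ lift p u) j

/-- Applying the relation at `T.adjugate *ᵥ u` gives a second expression involving `c`; multiplying
it with the relation at `w` eliminates `c`. What is left has no existential quantifier, so it passes
to limits. -/
theorem Intertwines.adjoint {d : ℕ} (hd : 1 ≤ d) {p q : (Fin (d + 1) → ℂ) × (Fin (d + 1) → ℂ)}
    {T : Matrix (Fin 2) (Fin 2) ℂ} (hT : T.det ≠ 0) (h : Intertwines (lift p) (lift q) T) :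
    Adjoint p q T := by
  obtain ⟨c, hc, h⟩ := h
  intro w u i j
  have h1 := h (T.adjugate *ᵥ u)
  rw [mulVec_mulVec, mul_adjugate, smul_mulVec, one_mulVec, lift_smul_vec] at h1
  have h2 := congrArg (T.adjugate *ᵥ ·) h1
  simp only [mulVec_smul, mulVec_mulVec, adjugate_mul] at h2
  rw [smul_mulVec, one_mulVec] at h2
  have h3 := congrFun h2 j
  simp only [Pi.smul_apply, smul_eq_mul] at h3
  have h4 : T.det ^ d = T.det ^ (d - 1) * T.det := by
    rw [← pow_succ, Nat.sub_add_cancel hd]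
  rw [h w, Pi.smul_apply, smul_eq_mul]
  rw [h4] at h3
  refine mul_left_cancel₀ hT ?_
  linear_combination (-(T *ᵥ lift q w) i) * h3

theorem exists_mulVec_ne_zero {T : Matrix (Fin 2) (Fin 2) ℂ} (hT : T ≠ 0) :
    ∃ w, T *ᵥ w ≠ 0 := by
  by_contra! h
  exact hT (ext_of_mulVec_single fun i => by rw [h, zero_mulVec])

theorem adjugate_ne_zero {T : Matrix (Fin 2) (Fin 2) ℂ} (hT : T ≠ 0) : T.adjugate ≠ 0 := by
  intro h
  rw [adjugate_fin_two] at h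
  apply hT
  ext i j
  have h00 := congrFun (congrFun h 0) 0
  have h01 := congrFun (congrFun h 0) 1
  have h10 := congrFun (congrFun h 1) 0
  have h11 := congrFun (congrFun h 1) 1
  simp at h00 h01 h10 h11
  fin_cases i <;> fin_cases j <;> simp [*]

theorem exists_lift_mulVec_ne_zero {d : ℕ} (hd : 1 ≤ d) (p : Coeffs d)
    {T : Matrix (Fin 2) (Fin 2) ℂ} (hT : T ≠ 0) : ∃ w i, lift p.1 (T *ᵥ w) i ≠ 0 := by
  obtain ⟨w, hw⟩ := exists_mulVec_ne_zero hT
  exact ⟨w, Function.ne_iff.1 (lift_ne_zero hd p hw)⟩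

/-- In degree at least two the exponent `d - 1` is positive, so a singular `T` kills the right-hand
side, whereas the left-hand side is nonzero for suitable vectors. This is where degenerate limits
are excluded. -/
theorem Adjoint.det_ne_zero {d : ℕ} (hd : 2 ≤ d) {p q : Coeffs d} {T : Matrix (Fin 2) (Fin 2) ℂ}
    (hT : T ≠ 0) (h : Adjoint p.1 q.1 T) : T.det ≠ 0 := by
  intro h0
  obtain ⟨w, i, hi⟩ := exists_lift_mulVec_ne_zero (by omega) p hT
  obtain ⟨u, j, hj⟩ := exists_lift_mulVec_ne_zero (by omega) q (adjugate_ne_zero hT)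
  have := h w u i j
  rw [h0, zero_pow (by omega), zero_mul, zero_mul] at this
  exact mul_ne_zero hi hj this

theorem Adjoint.intertwines {d : ℕ} (hd : 2 ≤ d) {p q : Coeffs d}
    {T : Matrix (Fin 2) (Fin 2) ℂ} (hT : T ≠ 0) (h : Adjoint p.1 q.1 T) :
    Intertwines (lift p.1) (lift q.1) T := by
  obtain ⟨u, j, hj⟩ := exists_lift_mulVec_ne_zero (by omega) q (adjugate_ne_zero hT)
  have key : ∀ v i, lift p.1 (T *ᵥ v) i =
      (T.det ^ (d - 1) * (T.adjugate *ᵥ lift p.1 u) j / lift q.1 (T.adjugate *ᵥ u) j) *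
        (T *ᵥ lift q.1 v) i := by
    intro v i
    have := h v u i j
    field_simp
    linear_combination this
  refine ⟨T.det ^ (d - 1) * (T.adjugate *ᵥ lift p.1 u) j / lift q.1 (T.adjugate *ᵥ u) j,
    fun h0 => ?_, fun v => funext (key v)⟩
  obtain ⟨w, i, hi⟩ := exists_lift_mulVec_ne_zero (by omega) p hT
  exact hi (by rw [key, h0, zero_mul])

theorem Intertwines.smul {d : ℕ} {p q : (Fin (d + 1) → ℂ) × (Fin (d + 1) → ℂ)}
    {T : Matrix (Fin 2) (Fin 2) ℂ} (h : Intertwines (lift p) (lift q) T) {r : ℂ} (hr : r ≠ 0) :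
    Intertwines (lift p) (lift q) (r • T) := by
  obtain ⟨c, hc, h⟩ := h
  refine ⟨r ^ d * c / r, div_ne_zero (mul_ne_zero (pow_ne_zero _ hr) hc) hr, fun v => ?_⟩
  rw [smul_mulVec, lift_smul_vec, h, smul_mulVec, smul_smul, smul_smul]
  congr 1
  field_simp

theorem isClosed_setOf_adjoint {d : ℕ} :
    IsClosed {x : (((Fin (d + 1) → ℂ) × (Fin (d + 1) → ℂ)) ×
      ((Fin (d + 1) → ℂ) × (Fin (d + 1) → ℂ))) × Matrix (Fin 2) (Fin 2) ℂ |
        Adjoint x.1.1 x.1.2 x.2} := by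
  simp only [Adjoint, Set.ofPred_forall]
  refine isClosed_iInter fun w => isClosed_iInter fun u => isClosed_iInter fun i =>
    isClosed_iInter fun j => isClosed_eq ?_ ?_
  · have h1 := continuous_lift.comp (Continuous.prodMk (continuous_fst.comp continuous_fst)
      (continuous_snd.matrix_mulVec (continuous_const (y := w))) :
        Continuous fun x : (((Fin (d + 1) → ℂ) × (Fin (d + 1) → ℂ)) ×
          ((Fin (d + 1) → ℂ) × (Fin (d + 1) → ℂ))) × Matrix (Fin 2) (Fin 2) ℂ => _)
    have h2 := continuous_lift.comp (Continuous.prodMk (continuous_snd.comp continuous_fst)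
      (continuous_snd.matrix_adjugate.matrix_mulVec (continuous_const (y := u))) :
        Continuous fun x : (((Fin (d + 1) → ℂ) × (Fin (d + 1) → ℂ)) ×
          ((Fin (d + 1) → ℂ) × (Fin (d + 1) → ℂ))) × Matrix (Fin 2) (Fin 2) ℂ => _)
    exact ((continuous_apply i).comp h1).mul ((continuous_apply j).comp h2)
  · have h1 := continuous_lift.comp (Continuous.prodMk (continuous_snd.comp continuous_fst)
      (continuous_const (y := w)) :
        Continuous fun x : (((Fin (d + 1) → ℂ) × (Fin (d + 1) → ℂ)) ×
          ((Fin (d + 1) → ℂ) × (Fin (d + 1) → ℂ))) × Matrix (Fin 2) (Fin 2) ℂ => _)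
    have h2 := continuous_lift.comp (Continuous.prodMk (continuous_fst.comp continuous_fst)
      (continuous_const (y := u)) :
        Continuous fun x : (((Fin (d + 1) → ℂ) × (Fin (d + 1) → ℂ)) ×
          ((Fin (d + 1) → ℂ) × (Fin (d + 1) → ℂ))) × Matrix (Fin 2) (Fin 2) ℂ => _)
    exact ((continuous_snd.matrix_det.pow _).mul
      (continuous_pi_iff.1 (continuous_snd.matrix_mulVec h1) i)).mul
        (continuous_pi_iff.1 (continuous_snd.matrix_adjugate.matrix_mulVec h2) j)

/-- Real rescaling puts `T` on the unit sphere, and projection along a compact factor is a closed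
map. -/
theorem isClosed_setOf_exists_intertwines {d : ℕ} (hd : 2 ≤ d) (f : Coeffs d → Coeffs d)
    (hf : Continuous f) {K : Set (Matrix (Fin 2) (Fin 2) ℂ)} (hK : IsClosed K)
    (hsmul : ∀ T ∈ K, ∀ r : ℝ, (r : ℂ) • T ∈ K) :
    IsClosed {p : Coeffs d | ∃ T : GL (Fin 2) ℂ, T.1 ∈ K ∧
      Intertwines (lift p.1) (lift (f p).1) T.1} := by
  let S := Metric.sphere (0 : Fin 2 → Fin 2 → ℂ) 1
  have : CompactSpace S := isCompact_iff_compactSpace.1 (isCompact_sphere _ _)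
  let m : S → Matrix (Fin 2) (Fin 2) ℂ := fun X => Matrix.of X.1
  have hm : Continuous m := continuous_subtype_val
  let Z : Set (Coeffs d × S) := {x | m x.2 ∈ K ∧ Adjoint x.1.1 (f x.1).1 (m x.2)}
  have hZ : IsClosed Z := by
    refine IsClosed.inter (hK.preimage (hm.comp continuous_snd)) ?_
    refine isClosed_setOf_adjoint.preimage (f := fun x : Coeffs d × S =>
      ((x.1.1, (f x.1).1), m x.2)) ?_
    exact ((continuous_subtype_val.comp continuous_fst).prodMk
      (continuous_subtype_val.comp (hf.comp continuous_fst))).prodMk (hm.comp continuous_snd)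
  convert isClosedMap_fst_of_compactSpace Z hZ using 1
  ext p
  constructor
  · rintro ⟨T, hTK, hT⟩
    have hT0 : T.1 ≠ 0 := T.isUnit.ne_zero
    let X : Fin 2 → Fin 2 → ℂ := T.1
    have hX : ‖X‖ ≠ 0 := norm_ne_zero_iff.2 hT0
    have hn : ((‖X‖⁻¹ : ℝ) : ℂ) ≠ 0 := Complex.ofReal_ne_zero.2 (inv_ne_zero hX)
    refine ⟨(p, ⟨((‖X‖⁻¹ : ℝ) : ℂ) • X, ?_⟩), ⟨hsmul _ hTK _,
      (hT.smul hn).adjoint (by omega) ?_⟩, rfl⟩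
    · rw [mem_sphere_zero_iff_norm, norm_smul, Complex.norm_real, norm_inv, norm_norm,
        inv_mul_cancel₀ hX]
    · rw [det_smul]
      exact mul_ne_zero (pow_ne_zero _ hn) (GeneralLinearGroup.det_ne_zero T)
  · rintro ⟨⟨p, X⟩, ⟨hTK, hTp⟩, rfl⟩
    have hT0 : m X ≠ 0 := by
      intro h
      have hX := X.2
      rw [show X.1 = 0 from h] at hX
      simp [S] at hX
    exact ⟨GeneralLinearGroup.mkOfDetNeZero (m X) (hTp.det_ne_zero hd hT0), hTK,
      hTp.intertwines hd hT0⟩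

theorem Coeffs.continuous_conj {d : ℕ} (hd : 1 ≤ d) :
    Continuous (Coeffs.conj hd : Coeffs d → Coeffs d) :=
  Continuous.subtype_mk (by fun_prop) _

theorem isClosed_setOf_antiInvolution {d : ℕ} (hd : 2 ≤ d) :
    IsClosed {p : Coeffs d | ∃ r < 0, HasAntiInvolution (Quotient.mk (proportional d) p) r} := by
  let c : Matrix (Fin 2) (Fin 2) ℂ → Matrix (Fin 2) (Fin 2) ℂ := fun T => T * T.map (starRingEnd ℂ)
  have hcont : Continuous c := by
    refine Continuous.matrix_mul continuous_id (continuous_id.matrix_map Complex.continuous_conj)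
  -- The condition `≤ 0` is used because it is closed; on invertible matrices the scalar cannot
  -- vanish, so it amounts to `< 0`.
  let K : Set (Matrix (Fin 2) (Fin 2) ℂ) :=
    {T | c T = ((c T 0 0).re : ℂ) • (1 : Matrix (Fin 2) (Fin 2) ℂ)} ∩ {T | (c T 0 0).re ≤ 0}
  have hre : Continuous fun T => (c T 0 0).re :=
    Complex.continuous_re.comp (hcont.matrix_elem 0 0)
  have hK : IsClosed K := by
    refine IsClosed.inter (isClosed_eq hcont ?_) (isClosed_le hre continuous_const)
    exact (Complex.continuous_ofReal.comp hre).smul continuous_const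
  have hsmul : ∀ T ∈ K, ∀ r : ℝ, (r : ℂ) • T ∈ K := by
    rintro T ⟨h1, h2⟩ r
    have hr : c ((r : ℂ) • T) = ((r * r : ℝ) : ℂ) • c T := by
      simp only [c]
      rw [Matrix.map_smulₛₗ _ (starRingEnd ℂ) (r : ℂ) (fun _ => by simp), smul_mul_smul_comm]
      simp
    have hr' : (c ((r : ℂ) • T) 0 0).re = r * r * (c T 0 0).re := by
      rw [hr, Matrix.smul_apply, smul_eq_mul, Complex.re_ofReal_mul]
    refine ⟨?_, ?_⟩
    · change c ((r : ℂ) • T) = ((c ((r : ℂ) • T) 0 0).re : ℂ) • 1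
      rw [hr', hr, Complex.ofReal_mul (r * r), mul_smul]
      exact congrArg (((r * r : ℝ) : ℂ) • ·) h1
    · change (c ((r : ℂ) • T) 0 0).re ≤ 0
      rw [hr']
      exact mul_nonpos_of_nonneg_of_nonpos (mul_self_nonneg r) h2
  convert isClosed_setOf_exists_intertwines hd _ (Coeffs.continuous_conj (by omega)) hK hsmul using 1
  ext p
  constructor
  · rintro ⟨r, hr, T, hT, h⟩
    have hc : c T.1 = (r : ℂ) • 1 := hT
    have hcr : (c T.1 0 0).re = r := by rw [hc]; simp
    refine ⟨T, ⟨?_, ?_⟩, (antiMobius_commute_iff (by omega) p T).1 h⟩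
    · change c T.1 = ((c T.1 0 0).re : ℂ) • 1
      rw [hcr, hc]
    · change (c T.1 0 0).re ≤ 0
      rw [hcr]
      exact hr.le
  · rintro ⟨T, ⟨h1, h2⟩, h⟩
    refine ⟨(c T.1 0 0).re, lt_of_le_of_ne h2 fun h0 => ?_, T, h1,
      (antiMobius_commute_iff (by omega) p T).2 h⟩
    have h1 : (T * conjGL T).1 = ((c T.1 0 0).re : ℂ) • 1 := h1
    rw [h0, Complex.ofReal_zero, zero_smul] at h1
    exact (T * conjGL T).isUnit.ne_zero h1

theorem isClosed_setOf_involution {d : ℕ} (hd : 2 ≤ d) :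
    IsClosed {p : Coeffs d | HasInvolution (Quotient.mk (proportional d) p)} := by
  have hK : IsClosed {T : Matrix (Fin 2) (Fin 2) ℂ | T.trace = 0} :=
    isClosed_eq continuous_id.matrix_trace continuous_const
  convert isClosed_setOf_exists_intertwines hd id continuous_id hK
    (fun T hT r => by
      change trace _ = 0
      rw [trace_smul, show T.trace = 0 from hT, smul_zero]) using 1
  ext p
  exact exists_congr fun A => and_congr Iff.rfl (smul_toFun_eq_iff (by omega) p p A)

theorem isClosed_cls_image {d : ℕ} {P : Rat d → Prop}
    (hP : ∀ φ ψ, Conjugate φ ψ → P φ → P ψ)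
    (h : IsClosed {p : Coeffs d | P (Quotient.mk (proportional d) p)}) :
    IsClosed {c : Moduli d | ∃ φ, P φ ∧ φ.cls = c} := by
  have h1 : IsClosed {φ : Rat d | P φ} :=
    (isQuotientMap_quotient_mk' (s := proportional d)).isClosed_preimage.1 h
  refine (isQuotientMap_quotient_mk' (s := conjugacy d)).isClosed_preimage.1 ?_
  convert h1 using 1
  ext φ
  constructor
  · rintro ⟨ψ, hψ, he⟩
    exact hP _ _ (Quotient.exact he) hψ
  · exact fun hφ => ⟨φ, hφ, rfl⟩

/-! ### Commuting Möbius maps have finite order -/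

theorem Intertwines.mul {F G H : (Fin 2 → ℂ) → Fin 2 → ℂ} {S T : Matrix (Fin 2) (Fin 2) ℂ}
    (hT : Intertwines F G T) (hS : Intertwines G H S) : Intertwines F H (T * S) := by
  obtain ⟨c, hc, h⟩ := hT
  obtain ⟨e, he, h'⟩ := hS
  refine ⟨c * e, mul_ne_zero hc he, fun v => ?_⟩
  rw [← mulVec_mulVec, h, h', mulVec_smul, smul_smul, mulVec_mulVec]

theorem Intertwines.pow {F : (Fin 2 → ℂ) → Fin 2 → ℂ} {T : Matrix (Fin 2) (Fin 2) ℂ}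
    (hT : Intertwines F F T) (n : ℕ) : Intertwines F F (T ^ n) := by
  induction n with
  | zero => exact ⟨1, one_ne_zero, fun v => by simp [-mulVec_fin_two]⟩
  | succ n ih => exact pow_succ T n ▸ ih.mul hT

theorem star_mulVec_eq (T : Matrix (Fin 2) (Fin 2) ℂ) (v : Fin 2 → ℂ) :
    T.map (starRingEnd ℂ) *ᵥ star v = star (T *ᵥ v) := by
  ext i
  fin_cases i <;> simp

theorem Intertwines.conj {d : ℕ} {p q : (Fin (d + 1) → ℂ) × (Fin (d + 1) → ℂ)}
    {T : Matrix (Fin 2) (Fin 2) ℂ} (h : Intertwines (lift p) (lift q) T) :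
    Intertwines (lift (star p)) (lift (star q)) (T.map (starRingEnd ℂ)) := by
  obtain ⟨c, hc, h⟩ := h
  refine ⟨star c, star_ne_zero.2 hc, fun v => ?_⟩
  obtain ⟨v, rfl⟩ := (star_involutive (R := Fin 2 → ℂ)).surjective v
  rw [star_mulVec_eq, lift_star, lift_star, star_mulVec_eq, h, star_smul]

/-- An eigenvalue of a `2 × 2` matrix is a root of its characteristic polynomial. -/
theorem eigenvalue_eq_or_eq {M : Matrix (Fin 2) (Fin 2) ℂ} {μ ν k : ℂ} (ht : M.trace = μ + ν)
    (hD : M.det = μ * ν) {x : Fin 2 → ℂ} (hx : x ≠ 0) (h : M *ᵥ x = k • x) : k = μ ∨ k = ν := by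
  have h0 : (M - k • (1 : Matrix (Fin 2) (Fin 2) ℂ)).det = 0 := by
    refine exists_mulVec_eq_zero_iff.1 ⟨x, hx, ?_⟩
    rw [sub_mulVec, h, smul_mulVec, one_mulVec, sub_self]
  rw [det_fin_two] at h0 hD
  rw [trace_fin_two] at ht
  simp at h0
  have : (k - μ) * (k - ν) = 0 := by linear_combination h0 - hD + k * ht
  rcases mul_eq_zero.1 this with h | h
  · exact Or.inl (sub_eq_zero.1 h)
  · exact Or.inr (sub_eq_zero.1 h)

theorem exists_eigenvector {M : Matrix (Fin 2) (Fin 2) ℂ} {μ ν : ℂ} (ht : M.trace = μ + ν)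
    (hD : M.det = μ * ν) : ∃ x : Fin 2 → ℂ, x ≠ 0 ∧ M *ᵥ x = μ • x := by
  have h0 : (M - μ • (1 : Matrix (Fin 2) (Fin 2) ℂ)).det = 0 := by
    rw [det_fin_two] at hD ⊢
    rw [trace_fin_two] at ht
    simp
    linear_combination hD - μ * ht
  obtain ⟨x, hx, h⟩ := exists_mulVec_eq_zero_iff.2 h0
  refine ⟨x, hx, ?_⟩
  rwa [sub_mulVec, smul_mulVec, one_mulVec, sub_eq_zero] at h

theorem pow_mulVec_of_eigenvector {M : Matrix (Fin 2) (Fin 2) ℂ} {μ : ℂ} {x : Fin 2 → ℂ}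
    (h : M *ᵥ x = μ • x) (n : ℕ) : M ^ n *ᵥ x = μ ^ n • x := by
  induction n with
  | zero => rw [pow_zero, pow_zero, one_mulVec, one_smul]
  | succ n ih => rw [pow_succ, ← mulVec_mulVec, h, mulVec_smul, ih, smul_smul, pow_succ, mul_comm]

theorem eq_zero_of_mulVec_eq_zero {N : Matrix (Fin 2) (Fin 2) ℂ} {u w : Fin 2 → ℂ}
    (h : u 0 * w 1 - u 1 * w 0 ≠ 0) (hu : N *ᵥ u = 0) (hw : N *ᵥ w = 0) : N = 0 := by
  ext i j
  have hu := congrFun hu i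
  have hw := congrFun hw i
  have e : ∀ x : Fin 2 → ℂ, (N *ᵥ x) i = N i 0 * x 0 + N i 1 * x 1 := fun x => by
    simp [Matrix.mulVec, dotProduct]
  rw [e] at hu hw
  refine (mul_eq_zero.1 ?_).resolve_right h
  simp only [Pi.zero_apply] at hu hw
  fin_cases j
  · simp only [Fin.zero_eta]; linear_combination w 1 * hu - u 1 * hw
  · simp only [Fin.mk_one]; linear_combination u 0 * hw - w 0 * hu

/-- The two fixed points of `M` are carried by `φ` into themselves: if `x` has eigenvalue `k`, then
its image is an eigenvector with eigenvalue `k ^ d / c`. Each possible action on the pair forces `μ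
/ ν` to be a root of unity. -/
theorem exists_pow_eq_of_ne {d : ℕ} (hd : 2 ≤ d) (p : Coeffs d) {M : Matrix (Fin 2) (Fin 2) ℂ}
    (hM : M.det ≠ 0) (h : Intertwines (lift p.1) (lift p.1) M) {μ ν : ℂ}
    (ht : M.trace = μ + ν) (hD : M.det = μ * ν) (hne : μ ≠ ν) :
    ∃ e, 1 ≤ e ∧ μ ^ e = ν ^ e ∧ M ^ e = μ ^ e • (1 : Matrix (Fin 2) (Fin 2) ℂ) := by
  obtain ⟨u, hu, hMu⟩ := exists_eigenvector ht hD
  obtain ⟨w, hw, hMw⟩ := exists_eigenvector (ht.trans (add_comm _ _)) (hD.trans (mul_comm _ _))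
  obtain ⟨c, hc, h⟩ := h
  have hμ : μ ≠ 0 := fun h0 => hM (by rw [hD, h0, zero_mul])
  have hν : ν ≠ 0 := fun h0 => hM (by rw [hD, h0, mul_zero])
  have key : ∀ (k : ℂ) (x : Fin 2 → ℂ), x ≠ 0 → M *ᵥ x = k • x → k ^ d = c * μ ∨ k ^ d = c * ν := by
    intro k x hx hk
    have h1 := h x
    rw [hk, lift_smul_vec] at h1
    have h2 : M *ᵥ lift p.1 x = (k ^ d / c) • lift p.1 x := by
      rw [div_eq_inv_mul, mul_smul, h1, smul_smul, inv_mul_cancel₀ hc, one_smul]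
    refine (eigenvalue_eq_or_eq ht hD (lift_ne_zero (by omega) p hx) h2).imp ?_ ?_ <;>
    · intro h
      rw [div_eq_iff hc] at h
      rw [h, mul_comm]
  have he : ∃ e, 1 ≤ e ∧ μ ^ e = ν ^ e := by
    have e1 : ∀ x : ℂ, x ^ d = x ^ (d - 1) * x := fun x => by
      rw [← pow_succ, Nat.sub_add_cancel (by omega)]
    -- Exponent `d` when both points go to the same one, `d - 1` when each is fixed, `d + 1` when
    -- they are exchanged.
    rcases key μ u hu hMu with h1 | h1 <;> rcases key ν w hw hMw with h2 | h2
    · exact ⟨d, by omega, h1.trans h2.symm⟩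
    · refine ⟨d - 1, by omega, ?_⟩
      rw [e1] at h1 h2
      rw [mul_right_cancel₀ hμ h1, mul_right_cancel₀ hν h2]
    · refine ⟨d + 1, by omega, ?_⟩
      rw [pow_succ, pow_succ, h1, h2]
      ring
    · exact ⟨d, by omega, h1.trans h2.symm⟩
  obtain ⟨e, he, hpow⟩ := he
  refine ⟨e, he, hpow, sub_eq_zero.1 (eq_zero_of_mulVec_eq_zero (u := u) (w := w) ?_ ?_ ?_)⟩
  · intro hdet
    obtain ⟨i, hi⟩ := Function.ne_iff.1 hu
    have hprop : u i • w = w i • u := by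
      ext j
      fin_cases i <;> fin_cases j <;> simp <;>
        first | exact mul_comm _ _ | linear_combination hdet | linear_combination -hdet
    have h1 := congrArg (M *ᵥ ·) hprop
    simp only [mulVec_smul, hMu, hMw] at h1
    have h2 : (u i * (ν - μ)) • w = 0 := by
      rw [mul_sub, sub_smul, mul_smul, h1, smul_comm, ← hprop, smul_smul, mul_comm μ, sub_self]
    rcases smul_eq_zero.1 h2 with h3 | h3
    · exact mul_ne_zero hi (sub_ne_zero.2 hne.symm) h3
    · exact hw h3
  · rw [sub_mulVec, pow_mulVec_of_eigenvector hMu, smul_mulVec, one_mulVec, sub_self]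
  · rw [sub_mulVec, pow_mulVec_of_eigenvector hMw, smul_mulVec, one_mulVec, hpow, sub_self]

/-- Up to the scalar `μ`, `M` translates the line `v + ℂ u` by `u / μ`. Since `μ ^ d = c * μ`,
iteration shows that the lift is affine along these translates. -/
theorem lift_add_smul_of_commute {d : ℕ} {p : (Fin (d + 1) → ℂ) × (Fin (d + 1) → ℂ)}
    {M : Matrix (Fin 2) (Fin 2) ℂ} {v u x y : Fin 2 → ℂ} {μ c : ℂ} (hμ : μ ≠ 0) (hc : c ≠ 0)
    (h : ∀ v, lift p (M *ᵥ v) = c • M *ᵥ lift p v) (hcd : μ ^ d = c * μ)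
    (hMv : M *ᵥ v = μ • v + u) (hMu : M *ᵥ u = μ • u)
    (hMx : M *ᵥ x = μ • x + y) (hMy : M *ᵥ y = μ • y) (hx : lift p v = x) (n : ℕ) :
    lift p (v + ((n : ℂ) / μ) • u) = x + ((n : ℂ) / μ) • y := by
  have step : ∀ v u : Fin 2 → ℂ, M *ᵥ v = μ • v + u → M *ᵥ u = μ • u → ∀ n : ℕ,
      M *ᵥ (v + ((n : ℂ) / μ) • u) = μ • (v + (((n + 1 : ℕ) : ℂ) / μ) • u) := by
    intro v u hMv hMu n
    rw [mulVec_add, mulVec_smul, hMv, hMu, smul_add, smul_smul, smul_smul, add_assoc]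
    congr 1
    rw [div_mul_cancel₀ _ hμ, mul_div_cancel₀ _ hμ]
    push_cast
    rw [add_smul, one_smul, add_comm]
  induction n with
  | zero => simp [hx]
  | succ n ih =>
    have h1 := h (v + ((n : ℂ) / μ) • u)
    rw [ih, step v u hMv hMu, step x y hMx hMy, lift_smul_vec, hcd, smul_smul] at h1
    exact smul_right_injective _ (mul_ne_zero hc hμ) h1

theorem continuous_lift_right {d : ℕ} (p : (Fin (d + 1) → ℂ) × (Fin (d + 1) → ℂ)) :
    Continuous (lift p) := by
  refine continuous_pi fun i => ?_
  fin_cases i <;> simp only [lift, form] <;> simp <;> fun_prop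

/-- The lift of a rational map of degree at least two grows faster than linearly along a line. -/
theorem not_lift_add_smul {d : ℕ} (hd : 2 ≤ d) (p : Coeffs d) {v u x y : Fin 2 → ℂ} (hu : u ≠ 0)
    {μ : ℂ} (hμ : μ ≠ 0) (hiter : ∀ n : ℕ, lift p.1 (v + ((n : ℂ) / μ) • u) =
      x + ((n : ℂ) / μ) • y) : False := by
  -- By homogeneity, dividing the argument by `(n + 1) / μ` turns affine growth into decay of order
  -- `d - 1`; in the limit the lift would vanish at `u`.
  have hval : ∀ n : ℕ, lift p.1 ((μ / ((n + 1 : ℕ) : ℂ)) • v + u) =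
      (μ / ((n + 1 : ℕ) : ℂ)) ^ d • x + (μ / ((n + 1 : ℕ) : ℂ)) ^ (d - 1) • y := by
    intro n
    have hn : ((n + 1 : ℕ) : ℂ) ≠ 0 := Nat.cast_ne_zero.2 n.succ_ne_zero
    have h0 : (μ / ((n + 1 : ℕ) : ℂ)) * (((n + 1 : ℕ) : ℂ) / μ) = 1 := by field_simp
    have hit := hiter (n + 1)
    generalize μ / ((n + 1 : ℕ) : ℂ) = z at *
    generalize ((n + 1 : ℕ) : ℂ) / μ = z' at *
    have h1 : z • v + u = z • (v + z' • u) := by rw [smul_add, smul_smul, h0, one_smul]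
    have h2 : z ^ d = z ^ (d - 1) * z := by rw [← pow_succ, Nat.sub_add_cancel (by omega)]
    have h3 : z ^ d * z' = z ^ (d - 1) := by rw [h2, mul_assoc, h0, mul_one]
    rw [h1, lift_smul_vec, hit, smul_add, smul_smul, h3]
  have hz : Filter.Tendsto (fun n : ℕ => μ / ((n + 1 : ℕ) : ℂ)) Filter.atTop (nhds 0) :=
    (Filter.tendsto_add_atTop_iff_nat (f := fun n : ℕ => μ / (n : ℂ)) 1).2
      (tendsto_const_div_atTop_nhds_zero_nat μ)
  obtain ⟨z, hz, hval⟩ : ∃ z : ℕ → ℂ, Filter.Tendsto z Filter.atTop (nhds 0) ∧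
      ∀ n, lift p.1 (z n • v + u) = z n ^ d • x + z n ^ (d - 1) • y :=
    ⟨fun n : ℕ => μ / ((n + 1 : ℕ) : ℂ), hz, hval⟩
  have hline : Continuous fun s : ℂ => s • v + u := by fun_prop
  have hcont : Continuous fun s : ℂ => lift p.1 (s • v + u) :=
    (continuous_lift_right p.1).comp hline
  have hcont' : Continuous fun s : ℂ => s ^ d • x + s ^ (d - 1) • y := by fun_prop
  have hl : Filter.Tendsto (fun n => lift p.1 (z n • v + u)) Filter.atTop
      (nhds (lift p.1 ((0 : ℂ) • v + u))) := (hcont.tendsto 0).comp hz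
  have hr : Filter.Tendsto (fun n => z n ^ d • x + z n ^ (d - 1) • y) Filter.atTop
      (nhds ((0 : ℂ) ^ d • x + (0 : ℂ) ^ (d - 1) • y)) := (hcont'.tendsto 0).comp hz
  simp only [hval] at hl
  have heq := tendsto_nhds_unique hl hr
  have hd0 : d ≠ 0 := by omega
  have hd1 : d - 1 ≠ 0 := by omega
  rw [zero_smul, zero_add, zero_pow hd0, zero_pow hd1, zero_smul, zero_smul, add_zero] at heq
  exact lift_ne_zero (by omega) p hu heq

/-- A rational map of degree at least two does not commute with a parabolic transformation. -/
theorem eq_smul_one_of_double_eigenvalue {d : ℕ} (hd : 2 ≤ d) (p : Coeffs d)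
    {M : Matrix (Fin 2) (Fin 2) ℂ} (hM : M.det ≠ 0)
    (h : Intertwines (lift p.1) (lift p.1) M) {μ : ℂ}
    (ht : M.trace = μ + μ) (hD : M.det = μ * μ) : M = μ • (1 : Matrix (Fin 2) (Fin 2) ℂ) := by
  by_contra hne
  have hμ : μ ≠ 0 := fun h0 => hM (by rw [hD, h0, zero_mul])
  obtain ⟨c, hc, h⟩ := h
  obtain ⟨v, hv⟩ := exists_mulVec_ne_zero (sub_ne_zero.2 hne)
  set u := (M - μ • (1 : Matrix (Fin 2) (Fin 2) ℂ)) *ᵥ v with hu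
  have hMv : M *ᵥ v = μ • v + u := by
    rw [hu, sub_mulVec, smul_mulVec, one_mulVec]; abel
  -- Cayley–Hamilton for a double eigenvalue.
  have hsq : (M - μ • (1 : Matrix (Fin 2) (Fin 2) ℂ)) *
      (M - μ • (1 : Matrix (Fin 2) (Fin 2) ℂ)) = 0 := by
    rw [det_fin_two] at hD
    rw [trace_fin_two] at ht
    ext i j
    fin_cases i <;> fin_cases j <;> simp [Matrix.mul_apply]
    · linear_combination M 0 0 * ht - hD
    · linear_combination M 0 1 * ht
    · linear_combination M 1 0 * ht
    · linear_combination M 1 1 * ht - hD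
  have hMu : M *ᵥ u = μ • u := by
    have : (M - μ • (1 : Matrix (Fin 2) (Fin 2) ℂ)) *ᵥ u = 0 := by
      rw [hu, mulVec_mulVec, hsq, zero_mulVec]
    rwa [sub_mulVec, smul_mulVec, one_mulVec, sub_eq_zero] at this
  have hcd : μ ^ d = c * μ := by
    have h1 := h u
    rw [hMu, lift_smul_vec] at h1
    have h2 : M *ᵥ lift p.1 u = (μ ^ d / c) • lift p.1 u := by
      rw [div_eq_inv_mul, mul_smul, h1, smul_smul, inv_mul_cancel₀ hc, one_smul]
    have h3 := (eigenvalue_eq_or_eq ht hD (lift_ne_zero (by omega) p hv) h2).elim id id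
    rw [div_eq_iff hc] at h3
    rw [h3, mul_comm]
  set x := lift p.1 v with hx
  set y := (M - μ • (1 : Matrix (Fin 2) (Fin 2) ℂ)) *ᵥ x with hy
  have hMx : M *ᵥ x = μ • x + y := by
    rw [hy, sub_mulVec, smul_mulVec, one_mulVec]; abel
  have hMy : M *ᵥ y = μ • y := by
    have : (M - μ • (1 : Matrix (Fin 2) (Fin 2) ℂ)) *ᵥ y = 0 := by
      rw [hy, mulVec_mulVec, hsq, zero_mulVec]
    rwa [sub_mulVec, smul_mulVec, one_mulVec, sub_eq_zero] at this
  have hiter := lift_add_smul_of_commute hμ hc h hcd hMv hMu hMx hMy hx.symm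
  exact not_lift_add_smul hd p hv hμ hiter

theorem exists_pow_eq_smul_one {d : ℕ} (hd : 2 ≤ d) (p : Coeffs d) {M : Matrix (Fin 2) (Fin 2) ℂ}
    (hM : M.det ≠ 0) (h : Intertwines (lift p.1) (lift p.1) M) :
    ∃ e, 1 ≤ e ∧ ∃ k : ℂ, M ^ e = k • (1 : Matrix (Fin 2) (Fin 2) ℂ) := by
  obtain ⟨s, hs⟩ := IsAlgClosed.exists_eq_mul_self (M.trace ^ 2 - 4 * M.det)
  have ht : M.trace = (M.trace + s) / 2 + (M.trace - s) / 2 := by ring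
  have hD : M.det = (M.trace + s) / 2 * ((M.trace - s) / 2) := by
    linear_combination (-1 / 4 : ℂ) * hs
  by_cases hne : (M.trace + s) / 2 = (M.trace - s) / 2
  · rw [← hne] at ht hD
    exact ⟨1, le_rfl, _, (pow_one M).trans (eq_smul_one_of_double_eigenvalue hd p hM h ht hD)⟩
  · obtain ⟨e, he, -, h'⟩ := exists_pow_eq_of_ne hd p hM h ht hD hne
    exact ⟨e, he, _, h'⟩

/-- The eigenvalues are real and positive, so equality of some positive powers makes them equal; the
parabolic case is already excluded. -/
theorem eq_smul_one_of_trace_sq_ge {d : ℕ} (hd : 2 ≤ d) (p : Coeffs d)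
    {M : Matrix (Fin 2) (Fin 2) ℂ} (h : Intertwines (lift p.1) (lift p.1) M) {t D : ℝ}
    (ht : M.trace = t) (hD : M.det = D) (ht0 : 0 < t) (hD0 : 0 < D) (htD : 4 * D ≤ t ^ 2) :
    ∃ s : ℝ, 0 < s ∧ M = (s : ℂ) • (1 : Matrix (Fin 2) (Fin 2) ℂ) := by
  have hs := Real.sq_sqrt (sub_nonneg.2 htD)
  set s := √(t ^ 2 - 4 * D)
  have hs0 : 0 ≤ s := Real.sqrt_nonneg _
  have hst : s < t := lt_of_pow_lt_pow_left₀ 2 ht0.le (by rw [hs]; linarith)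
  have hM : M.det ≠ 0 := by rw [hD]; exact Complex.ofReal_ne_zero.2 hD0.ne'
  have ht' : M.trace = (((t + s) / 2 : ℝ) : ℂ) + (((t - s) / 2 : ℝ) : ℂ) := by
    rw [ht]; push_cast; ring
  have hD' : M.det = (((t + s) / 2 : ℝ) : ℂ) * (((t - s) / 2 : ℝ) : ℂ) := by
    rw [hD, ← Complex.ofReal_mul]
    congr 1
    linear_combination (1 / 4 : ℝ) * hs
  have heq : (((t + s) / 2 : ℝ) : ℂ) = (((t - s) / 2 : ℝ) : ℂ) := by
    by_contra hne
    obtain ⟨e, he, hpow, -⟩ := exists_pow_eq_of_ne hd p hM h ht' hD' hne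
    rw [← Complex.ofReal_pow, ← Complex.ofReal_pow, Complex.ofReal_inj] at hpow
    exact hne (congrArg _ ((pow_left_inj₀ (by linarith) (by linarith) (by omega)).1 hpow))
  rw [← heq] at ht' hD'
  exact ⟨(t + s) / 2, by linarith, eq_smul_one_of_double_eigenvalue hd p hM h ht' hD'⟩

/-! ### Reflections and real maps -/

theorem map_conj_mul (S T : Matrix (Fin 2) (Fin 2) ℂ) :
    (S * T).map (starRingEnd ℂ) = S.map (starRingEnd ℂ) * T.map (starRingEnd ℂ) :=
  Matrix.map_mul

theorem map_conj_smul (c : ℂ) (T : Matrix (Fin 2) (Fin 2) ℂ) :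
    (c • T).map (starRingEnd ℂ) = star c • T.map (starRingEnd ℂ) := by
  ext i j
  simp

theorem map_conj_one : (1 : Matrix (Fin 2) (Fin 2) ℂ).map (starRingEnd ℂ) = 1 :=
  Matrix.map_one _ (map_zero _) (map_one _)

theorem map_conj_conj (T : Matrix (Fin 2) (Fin 2) ℂ) :
    (T.map (starRingEnd ℂ)).map (starRingEnd ℂ) = T := by
  ext i j
  simp

/-- A version of Hilbert's Theorem 90 for `2 × 2` matrices. -/
theorem exists_mul_conj_eq_smul {T : Matrix (Fin 2) (Fin 2) ℂ} {s : ℝ} (hs : 0 < s)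
    (hT : T * T.map (starRingEnd ℂ) = ((s ^ 2 : ℝ) : ℂ) • (1 : Matrix (Fin 2) (Fin 2) ℂ)) :
    ∃ S : GL (Fin 2) ℂ, T * (conjGL S).1 = (s : ℂ) • S.1 := by
  -- Averaging over the antilinear involution `v ↦ s⁻¹ T (conj v)`, starting from the scalar matrix
  -- `s θ`. Testing `θ` at `1`, `I` and `1 + I` is enough to find an invertible value.
  let f : ℂ → Matrix (Fin 2) (Fin 2) ℂ := fun θ => (s * θ) • 1 + star θ • T
  have hf : ∀ θ, T * (f θ).map (starRingEnd ℂ) = (s : ℂ) • f θ := by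
    intro θ
    have : (f θ).map (starRingEnd ℂ) = (s * star θ) • 1 + θ • T.map (starRingEnd ℂ) := by
      rw [show f θ = _ from rfl, Matrix.map_add _ (map_add _), map_conj_smul, map_conj_smul,
        map_conj_one]
      simp
    rw [this, mul_add, mul_smul_comm, mul_smul_comm, hT, mul_one, smul_add, smul_smul, smul_smul,
      smul_smul, add_comm]
    congr 2
    push_cast
    ring
  have hdet : ∀ θ, (f θ).det = (s * θ) ^ 2 + s * θ * star θ * T.trace + star θ ^ 2 * T.det := by
    intro θ
    simp only [f, det_fin_two, trace_fin_two]
    simp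
    ring
  have hs' : (s : ℂ) ≠ 0 := Complex.ofReal_ne_zero.2 hs.ne'
  have : ∃ θ, (f θ).det ≠ 0 := by
    by_contra! h
    have h1 := (hdet 1).symm.trans (h 1)
    have h2 := (hdet Complex.I).symm.trans (h _)
    have h3 := (hdet (1 + Complex.I)).symm.trans (h _)
    simp at h1 h2 h3
    have hI := Complex.I_mul_I
    have ht : (s : ℂ) * T.trace = 0 := by
      linear_combination (1 / 2 : ℂ) * h1 + (1 / 2 : ℂ) * h2 -
        (1 / 2 : ℂ) * (s ^ 2 - s * T.trace) * hI
    have h4 : (4 : ℂ) * Complex.I * s ^ 2 = 0 := by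
      linear_combination h3 + 2 * Complex.I * h1 - (2 + 2 * Complex.I) * ht +
        (-(s ^ 2 : ℂ) + s * T.trace - T.det) * hI
    simp [hs'] at h4
  obtain ⟨θ, hθ⟩ := this
  exact ⟨GeneralLinearGroup.mkOfDetNeZero (f θ) hθ, hf θ⟩

theorem isReal_of_conj_eq_smul {d : ℕ} (hd : 1 ≤ d) (q : Coeffs d) {c : ℂ} (h : q.1 = c • star q.1) :
    HasRealCoeffs (Quotient.mk (proportional d) q) := by
  have h1 : ∀ k, q.1.1 k = c * star (q.1.1 k) := fun k => congrFun (congrArg Prod.fst h) k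
  have h2 : ∀ k, q.1.2 k = c * star (q.1.2 k) := fun k => congrFun (congrArg Prod.snd h) k
  have hc : c ≠ 0 := by
    rintro rfl
    refine lift_ne_zero hd q (v := ![1, 0]) (by simp) ?_
    rw [h, lift_smul, zero_smul]
  -- Any nonzero coefficient serves as `a`; dividing by it makes all coefficients real.
  have h3 : ∃ a : ℂ, a ≠ 0 ∧ a = c * star a := by
    by_contra! h3
    refine lift_ne_zero hd q (v := ![1, 0]) (by simp) ?_
    have h4 : q.1.1 = 0 := funext fun k => by
      by_contra hk
      exact h3 _ hk (h1 k)
    have h5 : q.1.2 = 0 := funext fun k => by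
      by_contra hk
      exact h3 _ hk (h2 k)
    simp [lift, form, h4, h5]
  obtain ⟨a, ha, hca⟩ := h3
  have him : ∀ x : ℂ, x = c * star x → (a⁻¹ * x).im = 0 := by
    intro x hx
    rw [← Complex.conj_eq_iff_im, ← Complex.star_def, star_mul', star_inv₀]
    have ha' : star a ≠ 0 := star_ne_zero.2 ha
    rw [inv_mul_eq_div, inv_mul_eq_div, div_eq_div_iff ha' ha]
    refine mul_left_cancel₀ hc ?_
    linear_combination x * hca - a * hx
  refine ⟨Coeffs.ofLift (a⁻¹ • q.1) fun v hv => ?_, ?_, fun k => ?_, fun k => ?_⟩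
  · rw [lift_smul]
    exact smul_ne_zero (inv_ne_zero ha) (lift_ne_zero hd q hv)
  · refine Quotient.sound ⟨a, ha, ?_⟩
    change q.1 = a • (a⁻¹ • q.1)
    rw [smul_smul, mul_inv_cancel₀ ha, one_smul]
  · exact him _ (h1 k)
  · exact him _ (h2 k)

/-- A rational map that commutes with a reflection is real. -/
theorem isReal_of_intertwines {d : ℕ} (hd : 1 ≤ d) (p : Coeffs d) {T : Matrix (Fin 2) (Fin 2) ℂ}
    {r : ℝ} (hr : 0 < r)
    (hT : T * T.map (starRingEnd ℂ) = (r : ℂ) • (1 : Matrix (Fin 2) (Fin 2) ℂ))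
    (h : Intertwines (lift p.1) (lift (star p.1)) T) :
    IsReal (Quotient.mk (proportional d) p) := by
  obtain ⟨S, hS⟩ := exists_mul_conj_eq_smul (Real.sqrt_pos.2 hr) (by rwa [Real.sq_sqrt hr.le])
  set s := √r
  have hs : (s : ℂ) ≠ 0 := Complex.ofReal_ne_zero.2 (Real.sqrt_pos.2 hr).ne'
  obtain ⟨q, hq, hq'⟩ := exists_conjugate_coeffs hd p S
  refine ⟨Quotient.mk (proportional d) q, ⟨S⁻¹, fun x => ?_⟩, ?_⟩
  · rw [inv_inv]
    exact hq' x
  have h1 : Intertwines (lift q.1) (lift p.1) S⁻¹.1 :=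
    ⟨1, one_ne_zero, fun v => by
      rw [hq, mulVec_mulVec, ← Units.val_mul, mul_inv_cancel, Units.val_one, one_mulVec, one_smul]⟩
  have h2 : Intertwines (lift p.1) (lift q.1) S.1 :=
    ⟨1, one_ne_zero, fun v => by
      rw [hq, mulVec_mulVec, ← Units.val_mul, mul_inv_cancel, Units.val_one, one_mulVec, one_smul]⟩
  have h3 := h1.mul (h.mul h2.conj)
  have h4 : S⁻¹.1 * (T * S.1.map (starRingEnd ℂ)) = (s : ℂ) • (1 : Matrix (Fin 2) (Fin 2) ℂ) := by
    rw [show T * S.1.map (starRingEnd ℂ) = (s : ℂ) • S.1 from hS, mul_smul_comm, ← Units.val_mul,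
      inv_mul_cancel, Units.val_one]
  rw [h4] at h3
  obtain ⟨c, -, hc⟩ := h3
  refine isReal_of_conj_eq_smul hd q (c := ((s : ℂ) ^ d)⁻¹ * (c * s)) (lift_injective ?_)
  funext v
  have := hc v
  rw [smul_mulVec, one_mulVec, smul_mulVec, one_mulVec, lift_smul_vec, smul_smul] at this
  rw [lift_smul, mul_smul, ← this, smul_smul, inv_mul_cancel₀ (pow_ne_zero _ hs), one_smul]

theorem HasRealCoeffs.hasAntiInvolution {d : ℕ} (hd : 1 ≤ d) {φ : Rat d} (h : HasRealCoeffs φ) :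
    HasAntiInvolution φ 1 := by
  obtain ⟨p, rfl, h1, h2⟩ := h
  refine ⟨1, ?_, (antiMobius_commute_iff hd p 1).2 ⟨1, one_ne_zero, fun v => ?_⟩⟩
  · rw [conjGL, map_one, Units.val_one, mul_one, Complex.ofReal_one, one_smul]
  · have : star p.1 = p.1 := by
      refine Prod.ext (funext fun k => ?_) (funext fun k => ?_)
      · exact Complex.conj_eq_iff_im.2 (h1 k)
      · exact Complex.conj_eq_iff_im.2 (h2 k)
    rw [this, one_smul, Units.val_one, one_mulVec, one_mulVec]

theorem IsReal.hasAntiInvolution {d : ℕ} (hd : 1 ≤ d) {φ : Rat d} (h : IsReal φ) :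
    HasAntiInvolution φ 1 := by
  obtain ⟨ψ, hc, h⟩ := h
  exact (h.hasAntiInvolution hd).conjugate ((conjugacy d).symm hc)

/-! ### Reduction to an involution or an anti-involution -/

/-- Conjugating gives `conj T * T = conj k`; bracketing `T * conj T * T` in two ways then yields `k
= conj k`. -/
theorem exists_real_of_mul_conj_eq_smul {T : GL (Fin 2) ℂ} {k : ℂ}
    (h : T.1 * T.1.map (starRingEnd ℂ) = k • (1 : Matrix (Fin 2) (Fin 2) ℂ)) :
    ∃ r : ℝ, r ≠ 0 ∧ k = r := by
  have hT : T.1 ≠ 0 := T.isUnit.ne_zero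
  have h1 : T.1.map (starRingEnd ℂ) * T.1 = star k • (1 : Matrix (Fin 2) (Fin 2) ℂ) := by
    have := congrArg (fun X => X.map (starRingEnd ℂ)) h
    simpa only [map_conj_mul, map_conj_conj, map_conj_smul, map_conj_one] using this
  have h2 : (k - star k) • T.1 = 0 := by
    have := mul_assoc T.1 (T.1.map (starRingEnd ℂ)) T.1
    rw [h, h1, smul_mul_assoc, one_mul, mul_smul_comm, mul_one] at this
    rw [sub_smul, this, sub_self]
  have h3 : star k = k := (sub_eq_zero.1 ((smul_eq_zero.1 h2).resolve_right hT)).symm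
  refine ⟨k.re, fun h0 => ?_, (Complex.conj_eq_iff_re.1 h3).symm⟩
  have hk : k = 0 := by rw [← Complex.conj_eq_iff_re.1 h3, h0, Complex.ofReal_zero]
  rw [hk, zero_smul] at h
  exact (T * conjGL T).isUnit.ne_zero h

theorem trace_eq_zero_or_eq_smul_one {B : Matrix (Fin 2) (Fin 2) ℂ} {k : ℂ}
    (h : B * B = k • (1 : Matrix (Fin 2) (Fin 2) ℂ)) :
    B.trace = 0 ∨ ∃ m : ℂ, B = m • (1 : Matrix (Fin 2) (Fin 2) ℂ) := by
  refine or_iff_not_imp_left.2 fun ht => ?_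
  have h00 := congrFun (congrFun h 0) 0
  have h01 := congrFun (congrFun h 0) 1
  have h10 := congrFun (congrFun h 1) 0
  have h11 := congrFun (congrFun h 1) 1
  simp [Matrix.mul_apply] at h00 h01 h10 h11
  rw [trace_fin_two] at ht
  have e1 : B 0 1 = 0 := (mul_eq_zero.1 (by linear_combination h01)).resolve_left ht
  have e2 : B 1 0 = 0 := (mul_eq_zero.1 (by linear_combination h10)).resolve_left ht
  have e3 : B 0 0 - B 1 1 = 0 :=
    (mul_eq_zero.1 (by linear_combination h00 - h11)).resolve_left ht
  refine ⟨B 0 0, ?_⟩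
  ext i j
  fin_cases i <;> fin_cases j <;> simp [e1, e2]
  linear_combination -e3

/-- With `M = T * conj T`, an exponent `2f` means that `M ^ f` squares to a scalar: it is an
involution, or is itself scalar and the exponent is halved. For exponent `2f + 1`, `M ^ f * T` gives
an anti-involution, since its product with its conjugate is `M ^ (2f + 1)`. -/
theorem hasInvolution_or_hasAntiInvolution_of_pow {d : ℕ} (hd : 1 ≤ d) (p : Coeffs d)
    {T : GL (Fin 2) ℂ} (hT : Intertwines (lift p.1) (lift (star p.1)) T.1) (e : ℕ) (he : 1 ≤ e)
    (k : ℂ) (h : (T * conjGL T).1 ^ e = k • (1 : Matrix (Fin 2) (Fin 2) ℂ)) :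
    HasInvolution (Quotient.mk (proportional d) p) ∨
      ∃ r : ℝ, r ≠ 0 ∧ HasAntiInvolution (Quotient.mk (proportional d) p) r := by
  have hM : Intertwines (lift p.1) (lift p.1) (T * conjGL T).1 := by
    have := hT.mul hT.conj
    rwa [star_star] at this
  induction e using Nat.strong_induction_on generalizing k with
  | _ e ih =>
    rcases Nat.even_or_odd' e with ⟨f, rfl | rfl⟩
    · have h2 : (T * conjGL T).1 ^ f * (T * conjGL T).1 ^ f =
          k • (1 : Matrix (Fin 2) (Fin 2) ℂ) := by
        rw [← pow_add, ← two_mul, h]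
      rcases trace_eq_zero_or_eq_smul_one h2 with h3 | ⟨m, hm⟩
      · refine Or.inl ⟨(T * conjGL T) ^ f, h3, ?_⟩
        exact (smul_toFun_eq_iff hd p p _).2 (by simpa using hM.pow f)
      · exact ih f (by omega) (by omega) m hm
    · have h1 : ((T * conjGL T) ^ f * T).1 * (conjGL ((T * conjGL T) ^ f * T)).1 =
          k • (1 : Matrix (Fin 2) (Fin 2) ℂ) := by
        have hcomm : T * conjGL ((T * conjGL T) ^ f) = (T * conjGL T) ^ f * T := by
          rw [conjGL, map_pow, map_mul]
          change T * (conjGL T * conjGL (conjGL T)) ^ f = _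
          rw [conjGL_conjGL]
          exact (mul_pow_mul T (conjGL T) f).symm
        have : (T * conjGL T) ^ f * T * conjGL ((T * conjGL T) ^ f * T) =
            (T * conjGL T) ^ (2 * f + 1) := by
          have hmul : ∀ X Y : GL (Fin 2) ℂ, conjGL (X * Y) = conjGL X * conjGL Y := map_mul _
          rw [hmul, ← mul_assoc, mul_assoc ((T * conjGL T) ^ f), hcomm, ← mul_assoc,
            ← pow_add, mul_assoc, ← pow_succ, two_mul]
        rw [← Units.val_mul, this, Units.val_pow_eq_pow_val, h]
      obtain ⟨r, hr, rfl⟩ := exists_real_of_mul_conj_eq_smul h1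
      refine Or.inr ⟨r, hr, _, h1, (antiMobius_commute_iff hd p _).2 ?_⟩
      simpa using (hM.pow f).mul hT

theorem AdmitsAntiholomorphic.hasInvolution_or_hasAntiInvolution {d : ℕ} (hd : 2 ≤ d) {φ : Rat d}
    (h : AdmitsAntiholomorphic φ) :
    HasInvolution φ ∨ ∃ r : ℝ, r ≠ 0 ∧ HasAntiInvolution φ r := by
  induction φ using Quotient.inductionOn with | _ p => ?_
  obtain ⟨T, hT⟩ := h
  have hT := (antiMobius_commute_iff (by omega) p T).1 hT
  have hM := hT.mul hT.conj
  rw [star_star] at hM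
  obtain ⟨e, he, k, hk⟩ := exists_pow_eq_smul_one hd p (GeneralLinearGroup.det_ne_zero (T * conjGL T)) hM
  exact hasInvolution_or_hasAntiInvolution_of_pow (by omega) p hT e he k hk

theorem HasAntiInvolution.isReal {d : ℕ} (hd : 1 ≤ d) {φ : Rat d} {r : ℝ} (hr : 0 < r)
    (h : HasAntiInvolution φ r) : IsReal φ := by
  induction φ using Quotient.inductionOn with | _ p => ?_
  obtain ⟨T, h1, hT⟩ := h
  exact isReal_of_intertwines hd p hr h1 ((antiMobius_commute_iff hd p T).1 hT)

/-! ### Antipodal symmetry together with an involution -/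

/-- Use the basis `e₁`, `T e₁`, the columns of `S`. They are independent: otherwise `c` would be
`|T₀₀|²`, hence nonnegative. -/
theorem exists_quaternionic_normal_form {T : GL (Fin 2) ℂ} {c : ℝ} (hc : c < 0)
    (hT : T.1 * (conjGL T).1 = (c : ℂ) • (1 : Matrix (Fin 2) (Fin 2) ℂ)) :
    ∃ S E : GL (Fin 2) ℂ, T = S * E * (conjGL S)⁻¹ ∧ E.1 = !![0, (c : ℂ); 1, 0] := by
  have h00 := congrFun (congrFun hT 0) 0
  have h10 := congrFun (congrFun hT 1) 0
  simp [Matrix.mul_apply] at h00 h10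
  have hγ : T.1 1 0 ≠ 0 := by
    intro h0
    rw [h0, map_zero, mul_zero, add_zero, Complex.mul_conj, Complex.ofReal_inj] at h00
    linarith [Complex.normSq_nonneg (T.1 0 0)]
  let S : GL (Fin 2) ℂ := GeneralLinearGroup.mkOfDetNeZero !![1, T.1 0 0; 0, T.1 1 0]
    (by simpa [det_fin_two] using hγ)
  let E : GL (Fin 2) ℂ := GeneralLinearGroup.mkOfDetNeZero !![0, (c : ℂ); 1, 0]
    (by simpa [det_fin_two] using hc.ne)
  refine ⟨S, E, eq_mul_inv_of_mul_eq (Units.ext ?_), rfl⟩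
  ext i j
  rw [Units.val_mul, Units.val_mul]
  fin_cases i <;> fin_cases j <;>
    simp [S, E, Matrix.mul_apply, GeneralLinearGroup.mkOfDetNeZero]
  · linear_combination h00
  · linear_combination h10

/-- The composite `B = T * conj A` is again an extended symmetry. In normal coordinates the trace
and determinant of `B * conj B` are positive with `4 det ≤ trace²`, so it is a positive scalar and
`B` is a reflection. -/
theorem isReal_of_hasInvolution_of_hasAntiInvolution {d : ℕ} (hd : 2 ≤ d) {φ : Rat d} {c : ℝ}
    (hc : c < 0) (h : HasAntiInvolution φ c) (h' : HasInvolution φ) : IsReal φ := by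
  induction φ using Quotient.inductionOn with | _ p => ?_
  obtain ⟨T, hTc, hT⟩ := h
  obtain ⟨A, htr, hA⟩ := h'
  have hT := (antiMobius_commute_iff (by omega) p T).1 hT
  have hA := (smul_toFun_eq_iff (by omega) p p A).1 hA
  have hB : Intertwines (lift p.1) (lift (star p.1)) (T * conjGL A).1 := hT.mul hA.conj
  have hM : Intertwines (lift p.1) (lift p.1)
      ((T * conjGL A).1 * (T * conjGL A).1.map (starRingEnd ℂ)) := by
    have := hB.mul hB.conj
    rwa [star_star] at this
  obtain ⟨S, E, hE, hEc⟩ := exists_quaternionic_normal_form hc hTc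
  obtain ⟨X, hX⟩ : ∃ X, X = S⁻¹ * A * S := ⟨_, rfl⟩
  have hXtr : X.1 1 1 = -X.1 0 0 := by
    have : X.1.trace = 0 := by
      rw [hX, mul_assoc, Units.val_mul, trace_mul_comm, ← Units.val_mul, mul_assoc, mul_inv_cancel,
        mul_one, htr]
    rw [trace_fin_two] at this
    linear_combination this
  have hMX : (T * conjGL A) * conjGL (T * conjGL A) =
      S * ((E * conjGL X) * conjGL (E * conjGL X)) * S⁻¹ := by
    have hA : A = S * X * S⁻¹ := by rw [hX]; group
    have e1 : T * conjGL A = S * (E * conjGL X) * (conjGL S)⁻¹ := by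
      rw [hE, hA, conjGL, conjGL, map_mul, map_mul, map_inv]
      group
    have e2 : conjGL (S * (E * conjGL X) * (conjGL S)⁻¹) =
        conjGL S * conjGL (E * conjGL X) * S⁻¹ := by
      rw [conjGL, map_mul, map_mul, map_inv]
      exact congrArg (fun X => _ * X⁻¹) (conjGL_conjGL S)
    rw [e1, e2]
    group
  set a := X.1 0 0
  set b := X.1 0 1
  set g := X.1 1 0
  have hEX : (E * conjGL X).1 = !![c * star g, -c * star a; star a, star b] := by
    rw [Units.val_mul, hEc]
    ext i j
    fin_cases i <;> fin_cases j <;> simp [Matrix.mul_apply, hXtr, a, b, g]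
  have hcEX : (conjGL (E * conjGL X)).1 = !![c * g, -c * a; a, b] := by
    change (E * conjGL X).1.map _ = _
    rw [hEX]
    ext i j
    fin_cases i <;> fin_cases j <;> simp
  have htrace : ((T * conjGL A) * conjGL (T * conjGL A)).1.trace =
      ((c ^ 2 * ‖g‖ ^ 2 + ‖b‖ ^ 2 - 2 * c * ‖a‖ ^ 2 : ℝ) : ℂ) := by
    rw [hMX, Units.val_mul, trace_mul_comm, ← Units.val_mul, ← mul_assoc, inv_mul_cancel, one_mul,
      Units.val_mul, hEX, hcEX, trace_fin_two]
    simp [Matrix.mul_apply]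
    rw [← Complex.mul_conj', ← Complex.mul_conj', ← Complex.mul_conj']
    ring
  have hdet : ((T * conjGL A) * conjGL (T * conjGL A)).1.det =
      ((c ^ 2 * ‖g * b + a ^ 2‖ ^ 2 : ℝ) : ℂ) := by
    have : (S * ((E * conjGL X) * conjGL (E * conjGL X)) * S⁻¹).1.det =
        ((E * conjGL X) * conjGL (E * conjGL X)).1.det := by
      rw [Units.val_mul, det_mul_comm, ← Units.val_mul, ← mul_assoc, inv_mul_cancel, one_mul]
    rw [hMX, this, Units.val_mul, det_mul, hEX, hcEX, det_fin_two, det_fin_two]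
    push_cast
    rw [← Complex.mul_conj']
    simp
    ring
  have hdet0 := GeneralLinearGroup.det_ne_zero ((T * conjGL A) * conjGL (T * conjGL A))
  have hn : g * b + a ^ 2 ≠ 0 := by
    intro h0
    rw [hdet, h0] at hdet0
    simp at hdet0
  have hn0 : 0 < ‖g * b + a ^ 2‖ := norm_pos_iff.2 hn
  have hle : ‖g * b + a ^ 2‖ ≤ ‖g‖ * ‖b‖ + ‖a‖ ^ 2 := by
    refine (norm_add_le _ _).trans_eq ?_
    rw [norm_mul, norm_pow]
  -- Triangle inequality for `|gb + a²|`, then `(c|g| + |b|)² ≥ 0`; squaring gives the discriminant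
  -- bound.
  have ht : 2 * (-c) * ‖g * b + a ^ 2‖ ≤ c ^ 2 * ‖g‖ ^ 2 + ‖b‖ ^ 2 - 2 * c * ‖a‖ ^ 2 := by
    have := mul_le_mul_of_nonneg_left hle (by linarith : 0 ≤ 2 * (-c))
    nlinarith [sq_nonneg (c * ‖g‖ + ‖b‖)]
  have hpos : 0 < 2 * (-c) * ‖g * b + a ^ 2‖ := by
    have : 0 < -c := by linarith
    positivity
  obtain ⟨s, hs, hMs⟩ := eq_smul_one_of_trace_sq_ge hd p hM htrace hdet (hpos.trans_le ht)
    (mul_pos (by nlinarith) (by positivity)) (by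
      have := pow_le_pow_left₀ hpos.le ht 2
      linarith)
  exact isReal_of_intertwines (by omega) p hs hMs hB

theorem lift_star_apply {d : ℕ} (p : (Fin (d + 1) → ℂ) × (Fin (d + 1) → ℂ)) (v : Fin 2 → ℂ) :
    lift (star p) v = star (lift p (star v)) := by
  rw [← lift_star, star_star]

/-! ### A pseudo-real map commuting with the antipodal map -/

/-- Setting `m = 1` and differentiating in `n` at `0` gives `p = 0` or `q = 0`, because `d ≥ 2`
leaves no linear term on the right. -/
theorem eq_zero_or_eq_zero_of_pow_eq {d : ℕ} (hd : 2 ≤ d) {p q a b : ℂ}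
    (h : ∀ m n : ℂ, (p * m + q * n) ^ d = a * m ^ d + b * n ^ d) : a = 0 ∨ b = 0 := by
  have hpoly : (Polynomial.C p + Polynomial.C q * Polynomial.X) ^ d =
      Polynomial.C a + Polynomial.C b * Polynomial.X ^ d := by
    refine Polynomial.funext fun z => ?_
    simpa using h 1 z
  have h' := congrArg (fun f => Polynomial.eval 0 (Polynomial.derivative f)) hpoly
  have hd1 : d - 1 ≠ 0 := by omega
  have hd0 : d ≠ 0 := by omega
  simp [Polynomial.derivative_pow, hd0, hd1] at h'
  have ha := h 1 0
  have hb := h 0 1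
  simp [hd0] at ha hb
  rcases h' with h' | h'
  · exact Or.inl (by rw [← ha, h', zero_pow hd0])
  · exact Or.inr (by rw [← hb, h', zero_pow hd0])

theorem exists_antipodal_coeffs (d : ℕ) : ∃ p : Coeffs d, ∀ v, lift p.1 v =
    ![Complex.I * (v 0 - v 1) ^ d, (v 0 + v 1) ^ d] := by
  obtain ⟨a, ha⟩ := exists_form_eq_pow_mul_pow 1 (-1) 0 0 d d 0 rfl
  obtain ⟨b, hb⟩ := exists_form_eq_pow_mul_pow 1 1 0 0 d d 0 rfl
  have h : ∀ v, lift (Complex.I • a, b) v = ![Complex.I * (v 0 - v 1) ^ d, (v 0 + v 1) ^ d] := by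
    intro v
    simp only [lift, form_smul, ha, hb]
    congr 1
    · ring
    · congr 1
      ring
  refine ⟨Coeffs.ofLift _ fun v hv h0 => hv ?_, h⟩
  rw [h] at h0
  have h1 : Complex.I * (v 0 - v 1) ^ d = 0 := congrFun h0 0
  have h2 : (v 0 + v 1) ^ d = 0 := congrFun h0 1
  have h1 := eq_zero_of_pow_eq_zero ((mul_eq_zero.1 h1).resolve_left Complex.I_ne_zero)
  have h2 := eq_zero_of_pow_eq_zero h2
  ext i
  fin_cases i
  · simp; linear_combination (1 / 2 : ℂ) * h1 + (1 / 2 : ℂ) * h2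
  · simp; linear_combination (1 / 2 : ℂ) * h2 - (1 / 2 : ℂ) * h1

theorem not_isReal_antipodal {d : ℕ} (hd : 2 ≤ d) {p : Coeffs d} (hp : ∀ v, lift p.1 v =
    ![Complex.I * (v 0 - v 1) ^ d, (v 0 + v 1) ^ d]) :
    ¬ IsReal (Quotient.mk (proportional d) p) := by
  intro hreal
  obtain ⟨T, hT, hcomm⟩ := hreal.hasAntiInvolution (by omega)
  obtain ⟨c, hc, h⟩ := (antiMobius_commute_iff (by omega) p T).1 hcomm
  have hI := Complex.I_mul_I
  have hd0 : d ≠ 0 := by omega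
  have h0 : ∀ x y : ℂ, Complex.I * ((T.1 0 0 - T.1 1 0) * x + (T.1 0 1 - T.1 1 1) * y) ^ d =
      c * (T.1 0 0 * (-Complex.I * (x - y) ^ d) + T.1 0 1 * (x + y) ^ d) := by
    intro x y
    have := congrFun (h ![x, y]) 0
    rw [lift_star_apply, hp, hp] at this
    simp at this
    rw [← sub_eq_zero] at this ⊢
    ring_nf at this ⊢
    exact this
  have h1 : ∀ x y : ℂ, ((T.1 0 0 + T.1 1 0) * x + (T.1 0 1 + T.1 1 1) * y) ^ d =
      c * (T.1 1 0 * (-Complex.I * (x - y) ^ d) + T.1 1 1 * (x + y) ^ d) := by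
    intro x y
    have := congrFun (h ![x, y]) 1
    rw [lift_star_apply, hp, hp] at this
    simp at this
    rw [← sub_eq_zero] at this ⊢
    ring_nf at this ⊢
    exact this
  have hdet := GeneralLinearGroup.det_ne_zero T
  rw [det_fin_two] at hdet
  have hTc := congrFun (congrFun hT 0) 0
  simp [Matrix.mul_apply] at hTc
  generalize T.1 0 0 = α at *
  generalize T.1 0 1 = β at *
  generalize T.1 1 0 = γ at *
  generalize T.1 1 1 = δ at *
  -- In the coordinates `m = x - y`, `n = x + y` each row compares a power of a linear form with a
  -- sum of two pure powers, so each row of `T` has a zero entry.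
  have r0 : α = 0 ∨ β = 0 := by
    have := eq_zero_or_eq_zero_of_pow_eq hd (p := ((α - γ) - (β - δ)) / 2)
      (q := ((α - γ) + (β - δ)) / 2) (a := -c * α) (b := -Complex.I * c * β) fun m n => by
        have := h0 ((m + n) / 2) ((n - m) / 2)
        rw [show (m + n) / 2 - (n - m) / 2 = m by ring,
          show (m + n) / 2 + (n - m) / 2 = n by ring] at this
        rw [show (α - γ - (β - δ)) / 2 * m + (α - γ + (β - δ)) / 2 * n =
          (α - γ) * ((m + n) / 2) + (β - δ) * ((n - m) / 2) by ring]
        refine mul_left_cancel₀ Complex.I_ne_zero ?_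
        linear_combination this + c * β * n ^ d * hI
    simpa [hc] using this
  have r1 : γ = 0 ∨ δ = 0 := by
    have := eq_zero_or_eq_zero_of_pow_eq hd (p := ((α + γ) - (β + δ)) / 2)
      (q := ((α + γ) + (β + δ)) / 2) (a := -Complex.I * c * γ) (b := c * δ) fun m n => by
        have := h1 ((m + n) / 2) ((n - m) / 2)
        rw [show (m + n) / 2 - (n - m) / 2 = m by ring,
          show (m + n) / 2 + (n - m) / 2 = n by ring] at this
        rw [show (α + γ - (β + δ)) / 2 * m + (α + γ + (β + δ)) / 2 * n =
          (α + γ) * ((m + n) / 2) + (β + δ) * ((n - m) / 2) by ring]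
        linear_combination this
    simpa [hc] using this
  rcases r0 with rfl | rfl <;> rcases r1 with rfl | rfl
  · simp at hdet
  -- Antidiagonal case: `T * conj T` would be the negative scalar `-|β|²`, not `1`.
  · have e := h0 1 (-1)
    simp [hd0] at e
    have e' : γ = -β := by linear_combination -e
    rw [e'] at hTc
    simp only [map_zero, map_neg, mul_zero, zero_add, mul_neg, Complex.mul_conj] at hTc
    have : -Complex.normSq β = 1 := by exact_mod_cast hTc
    linarith [Complex.normSq_nonneg β]
  -- Diagonal case: `T` is scalar, and the factor `I` in the numerator contradicts commutation with
  -- conjugation.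
  · have e := h0 1 1
    simp [hd0] at e
    have e' : δ = α := by linear_combination -e
    subst e'
    have e1 := h0 1 0
    have e2 := h1 1 0
    simp at e1 e2
    have hδ : δ ≠ 0 := by
      rintro rfl
      simp at hdet
    have : 2 * Complex.I * c * δ = 0 := by linear_combination e1 - Complex.I * e2
    simp [hc, hδ] at this
  · simp at hdet

theorem exists_pseudoReal_antiInvolution {d : ℕ} (hd : 2 ≤ d) (hodd : Odd d) :
    ∃ φ : Rat d, IsPseudoReal φ ∧ ∃ r < 0, HasAntiInvolution φ r := by
  obtain ⟨p, hp⟩ := exists_antipodal_coeffs d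
  let T : GL (Fin 2) ℂ := GeneralLinearGroup.mkOfDetNeZero !![0, -1; 1, 0] (by simp [det_fin_two])
  have hT : ∀ x, antiMobius T (p.toFun x) = p.toFun (antiMobius T x) := by
    refine (antiMobius_commute_iff (by omega) p T).2 ⟨Complex.I, Complex.I_ne_zero, fun v => ?_⟩
    have hTv : ∀ v, T.1 *ᵥ v = ![-v 1, v 0] := fun v => by
      simp [T, GeneralLinearGroup.mkOfDetNeZero]
      exact ⟨rfl, rfl⟩
    have hstar : lift (star p.1) v = ![-Complex.I * (v 0 - v 1) ^ d, (v 0 + v 1) ^ d] := by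
      rw [lift_star_apply, hp]
      ext i
      fin_cases i <;> simp
    have e : (-v 1 - v 0) ^ d = -(v 0 + v 1) ^ d := by rw [← hodd.neg_pow]; congr 1; ring
    have e' : (-v 1 + v 0) ^ d = (v 0 - v 1) ^ d := by congr 1; ring
    have hI := Complex.I_mul_I
    rw [hTv, hp, hstar, hTv]
    ext i
    fin_cases i
    · change Complex.I * (-v 1 - v 0) ^ d = Complex.I * -(v 0 + v 1) ^ d
      rw [e]
    · change (-v 1 + v 0) ^ d = Complex.I * (-Complex.I * (v 0 - v 1) ^ d)
      rw [e']
      linear_combination (v 0 - v 1) ^ d * hI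
  refine ⟨Quotient.mk _ p, ⟨⟨T, hT⟩, not_isReal_antipodal hd hp⟩, -1, by norm_num, T, ?_, hT⟩
  ext i j
  fin_cases i <;> fin_cases j <;>
    simp [T, GeneralLinearGroup.mkOfDetNeZero, Matrix.mul_apply]

/-! ### Pseudo-real maps commuting with an involution -/

/-- The divergence of a vector field on `ℂ²`. -/
def divergence (F : (Fin 2 → ℂ) → Fin 2 → ℂ) (v : Fin 2 → ℂ) : ℂ :=
  fderiv ℂ F v (Pi.single 0 1) 0 + fderiv ℂ F v (Pi.single 1 1) 1

theorem divergence_eq_trace (F : (Fin 2 → ℂ) → Fin 2 → ℂ) (v : Fin 2 → ℂ) :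
    divergence F v = (LinearMap.toMatrix' (fderiv ℂ F v : (Fin 2 → ℂ) →ₗ[ℂ] Fin 2 → ℂ)).trace := by
  rw [trace_fin_two, LinearMap.toMatrix'_apply, LinearMap.toMatrix'_apply, divergence]
  simp

/-- The chain rule gives `DF(Bw) B = c B DG(w)`; multiply by `B⁻¹` on the right and take traces. -/
theorem divergence_mulVec {F G : (Fin 2 → ℂ) → Fin 2 → ℂ} (hF : Differentiable ℂ F)
    (hG : Differentiable ℂ G) {B : Matrix (Fin 2) (Fin 2) ℂ} (hB : B.det ≠ 0) {c : ℂ}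
    (h : ∀ v, F (B *ᵥ v) = c • B *ᵥ G v) (w : Fin 2 → ℂ) :
    divergence F (B *ᵥ w) = c * divergence G w := by
  let L : (Fin 2 → ℂ) →L[ℂ] Fin 2 → ℂ := LinearMap.toContinuousLinearMap (toLin' B)
  have hL : ∀ v, L v = B *ᵥ v := fun v => rfl
  have h1 : HasFDerivAt (fun v => F (L v)) ((fderiv ℂ F (L w)).comp L) w :=
    (hF _).hasFDerivAt.comp w L.hasFDerivAt
  have h2 : HasFDerivAt (fun v => c • L (G v)) (c • L.comp (fderiv ℂ G w)) w :=
    (L.hasFDerivAt.comp w (hG w).hasFDerivAt).const_smul c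
  have h3 : (fun v => F (L v)) = fun v => c • L (G v) := funext h
  rw [h3] at h1
  have h4 := congrArg (fun A : (Fin 2 → ℂ) →L[ℂ] Fin 2 → ℂ =>
    LinearMap.toMatrix' (A : (Fin 2 → ℂ) →ₗ[ℂ] Fin 2 → ℂ)) (h1.unique h2)
  have hLB : LinearMap.toMatrix' (L : (Fin 2 → ℂ) →ₗ[ℂ] Fin 2 → ℂ) = B := by
    simp [L]
  simp only [ContinuousLinearMap.toLinearMap_comp, ContinuousLinearMap.toLinearMap_smul, map_smul,
    LinearMap.toMatrix'_comp, hLB] at h4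
  rw [divergence_eq_trace, divergence_eq_trace, ← hL]
  have hu : IsUnit B.det := isUnit_iff_ne_zero.2 hB
  have h5 := congrArg (fun X => (X * B⁻¹).trace) h4
  simp only [mul_assoc, mul_nonsing_inv _ hu, mul_one, smul_mul_assoc, trace_smul] at h5
  rw [h5, trace_mul_comm, mul_assoc, nonsing_inv_mul _ hu, mul_one, smul_eq_mul]

theorem divergence_eq {F : (Fin 2 → ℂ) → Fin 2 → ℂ} (hF : Differentiable ℂ F) {x y a b : ℂ}
    (h0 : HasDerivAt (fun t => F ![t, y] 0) a x) (h1 : HasDerivAt (fun t => F ![x, t] 1) b y) :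
    divergence F ![x, y] = a + b := by
  have e0 : HasDerivAt (fun t : ℂ => (![t, y] : Fin 2 → ℂ)) (Pi.single 0 1) x := by
    rw [hasDerivAt_pi]
    intro i
    fin_cases i
    · exact (hasDerivAt_id x).congr_deriv (by simp)
    · simpa using hasDerivAt_const x y
  have e1 : HasDerivAt (fun t : ℂ => (![x, t] : Fin 2 → ℂ)) (Pi.single 1 1) y := by
    rw [hasDerivAt_pi]
    intro i
    fin_cases i
    · simpa using hasDerivAt_const y x
    · exact (hasDerivAt_id y).congr_deriv (by simp)
  have f0 := hasDerivAt_pi.1 ((hF ![x, y]).hasFDerivAt.comp_hasDerivAt x e0) 0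
  have f1 := hasDerivAt_pi.1 ((hF ![x, y]).hasFDerivAt.comp_hasDerivAt y e1) 1
  rw [divergence, f0.unique h0, f1.unique h1]

/-- Symmetries of a map whose divergence is a multiple of `(xy)^n` preserve the set of the two
coordinate axes. -/
theorem diagonal_or_antidiagonal {F G : (Fin 2 → ℂ) → Fin 2 → ℂ} (hF : Differentiable ℂ F)
    (hG : Differentiable ℂ G) {B : Matrix (Fin 2) (Fin 2) ℂ} (hB : B.det ≠ 0) {c κ κ' : ℂ}
    (h : ∀ v, F (B *ᵥ v) = c • B *ᵥ G v) {n : ℕ} (hn : n ≠ 0) (hκ : κ ≠ 0)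
    (hdF : ∀ x y, divergence F ![x, y] = κ * (x * y) ^ n)
    (hdG : ∀ x y, divergence G ![x, y] = κ' * (x * y) ^ n) :
    (B 0 1 = 0 ∧ B 1 0 = 0) ∨ (B 0 0 = 0 ∧ B 1 1 = 0) := by
  have h0 := divergence_mulVec hF hG hB h ![1, 0]
  have h1 := divergence_mulVec hF hG hB h ![0, 1]
  rw [mulVec_fin_two, hdF, hdG] at h0 h1
  simp [hn, hκ] at h0 h1
  rw [det_fin_two] at hB
  rcases h0 with h0 | h0 <;> rcases h1 with h1 | h1
  · simp [h0, h1] at hB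
  · exact Or.inr ⟨h0, h1⟩
  · exact Or.inl ⟨h1, h0⟩
  · simp [h0, h1] at hB

/-- The forms used for degrees congruent to three modulo four. -/
def swapField (n : ℕ) (a b : ℂ) (v : Fin 2 → ℂ) : Fin 2 → ℂ :=
  ![-v 1 ^ (2 * n + 1) + a * (v 0 ^ (n + 1) * v 1 ^ n),
    v 0 ^ (2 * n + 1) + b * (v 0 ^ n * v 1 ^ (n + 1))]

/-- The forms used for degrees congruent to one modulo four. -/
def fixField (n : ℕ) (a b : ℂ) (v : Fin 2 → ℂ) : Fin 2 → ℂ :=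
  ![-v 0 ^ (2 * n + 1) - (2 * n + 1) * (v 0 * v 1 ^ (2 * n)) + a * (v 0 ^ (n + 1) * v 1 ^ n),
    v 1 ^ (2 * n + 1) + (2 * n + 1) * (v 0 ^ (2 * n) * v 1) + b * (v 0 ^ n * v 1 ^ (n + 1))]

theorem differentiable_swapField (n : ℕ) (a b : ℂ) : Differentiable ℂ (swapField n a b) := by
  refine differentiable_pi.2 fun i => ?_
  fin_cases i <;> simp only [swapField] <;> simp <;> fun_prop

theorem differentiable_fixField (n : ℕ) (a b : ℂ) : Differentiable ℂ (fixField n a b) := by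
  refine differentiable_pi.2 fun i => ?_
  fin_cases i <;> simp only [fixField] <;> simp <;> fun_prop

theorem divergence_swapField (n : ℕ) (a b x y : ℂ) :
    divergence (swapField n a b) ![x, y] = ((n + 1) * (a + b)) * (x * y) ^ n := by
  have h0 : HasDerivAt (fun t => swapField n a b ![t, y] 0) (a * ((n + 1) * x ^ n * y ^ n)) x := by
    have := (((hasDerivAt_pow (n + 1) x).mul_const (y ^ n)).const_mul a).const_add
      (-y ^ (2 * n + 1))
    simpa [swapField] using this
  have h1 : HasDerivAt (fun t => swapField n a b ![x, t] 1) (b * (x ^ n * ((n + 1) * y ^ n))) y := by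
    have := (((hasDerivAt_pow (n + 1) y).const_mul (x ^ n)).const_mul b).const_add
      (x ^ (2 * n + 1))
    simpa [swapField] using this
  rw [divergence_eq (differentiable_swapField n a b) h0 h1, mul_pow]
  ring

/-- The coefficients `2n + 1` are chosen so that the pure powers cancel in the divergence. -/
theorem divergence_fixField (n : ℕ) (a b x y : ℂ) :
    divergence (fixField n a b) ![x, y] = ((n + 1) * (a + b)) * (x * y) ^ n := by
  have h0 : HasDerivAt (fun t => fixField n a b ![t, y] 0)
      (-((2 * n + 1) * x ^ (2 * n)) - (2 * n + 1) * (1 * y ^ (2 * n)) +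
        a * ((n + 1) * x ^ n * y ^ n)) x := by
    have := ((hasDerivAt_pow (2 * n + 1) x).neg.sub (((hasDerivAt_id x).mul_const
      (y ^ (2 * n))).const_mul (2 * n + 1 : ℂ))).add
        (((hasDerivAt_pow (n + 1) x).mul_const (y ^ n)).const_mul a)
    exact this.congr_deriv (by simp)
  have h1 : HasDerivAt (fun t => fixField n a b ![x, t] 1)
      ((2 * n + 1) * y ^ (2 * n) + (2 * n + 1) * (x ^ (2 * n) * 1) +
        b * (x ^ n * ((n + 1) * y ^ n))) y := by
    have := ((hasDerivAt_pow (2 * n + 1) y).add (((hasDerivAt_id y).const_mul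
      (x ^ (2 * n))).const_mul (2 * n + 1 : ℂ))).add
        (((hasDerivAt_pow (n + 1) y).const_mul (x ^ n)).const_mul b)
    exact this.congr_deriv (by simp)
  rw [divergence_eq (differentiable_fixField n a b) h0 h1, mul_pow]
  ring

theorem star_swapField (n : ℕ) (a b : ℂ) (v : Fin 2 → ℂ) :
    star (swapField n a b (star v)) = swapField n (star a) (star b) v := by
  ext i
  fin_cases i <;> simp [swapField]

theorem star_fixField (n : ℕ) (a b : ℂ) (v : Fin 2 → ℂ) :
    star (fixField n a b (star v)) = fixField n (star a) (star b) v := by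
  ext i
  fin_cases i <;> simp [fixField]

theorem exists_form_eq_monomial {d k m : ℕ} (h : k + m = d) :
    ∃ b : Fin (d + 1) → ℂ, ∀ v, form b v = v 0 ^ k * v 1 ^ m := by
  obtain ⟨b, hb⟩ := exists_form_eq_pow_mul_pow 1 0 0 1 d k m h
  exact ⟨b, fun v => by rw [hb]; ring⟩

theorem swapField_ne_zero (n : ℕ) {a b : ℂ} (hab : 1 + a * b ≠ 0) {v : Fin 2 → ℂ} (hv : v ≠ 0) :
    swapField n a b v ≠ 0 := by
  intro h
  have h0 : -v 1 ^ (2 * n + 1) + a * (v 0 ^ (n + 1) * v 1 ^ n) = 0 := congrFun h 0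
  have h1 : v 0 ^ (2 * n + 1) + b * (v 0 ^ n * v 1 ^ (n + 1)) = 0 := congrFun h 1
  have hx : v 0 ≠ 0 := by
    intro hx
    apply hv
    have hy : v 1 = 0 := by simpa [hx] using h0
    ext i; fin_cases i <;> assumption
  have hy : v 1 ≠ 0 := by
    intro hy
    simp [hy, hx] at h1
  have e0 : v 1 ^ (n + 1) = a * v 0 ^ (n + 1) := by
    refine mul_left_cancel₀ (pow_ne_zero n hy) ?_
    linear_combination -h0
  have e1 : v 0 ^ (n + 1) + b * v 1 ^ (n + 1) = 0 := by
    refine (mul_eq_zero.1 ?_).resolve_left (pow_ne_zero n hx)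
    linear_combination h1
  refine mul_ne_zero hab (pow_ne_zero (n + 1) hx) ?_
  linear_combination e1 - b * e0

/-- At a common zero, put `X = |x|^n` and `Y = |y|^n`. Adding the norm estimates gives `5(X² + Y²) ≤
X² + Y² + 4XY`, which is impossible for positive `X` and `Y`; this uses `2n + 1 ≥ 5`. -/
theorem fixField_ne_zero {n : ℕ} (hn : 2 ≤ n) {a b : ℂ} (ha : ‖a‖ ≤ 2) (hb : ‖b‖ ≤ 2)
    {v : Fin 2 → ℂ} (hv : v ≠ 0) : fixField n a b v ≠ 0 := by
  intro h
  have h0 : -v 0 ^ (2 * n + 1) - (2 * n + 1) * (v 0 * v 1 ^ (2 * n)) +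
    a * (v 0 ^ (n + 1) * v 1 ^ n) = 0 := congrFun h 0
  have h1 : v 1 ^ (2 * n + 1) + (2 * n + 1) * (v 0 ^ (2 * n) * v 1) +
    b * (v 0 ^ n * v 1 ^ (n + 1)) = 0 := congrFun h 1
  have hn0 : n ≠ 0 := by omega
  have hx : v 0 ≠ 0 := by
    intro hx
    apply hv
    have hy : v 1 = 0 := by simpa [hx, hn0] using h1
    ext i; fin_cases i <;> assumption
  have hy : v 1 ≠ 0 := by
    intro hy
    simp [hy, hx, hn0] at h0
  have e0 : ((2 * n + 1 : ℕ) : ℂ) * (v 1 ^ n) ^ 2 = -(v 0 ^ n) ^ 2 + a * (v 0 ^ n * v 1 ^ n) := by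
    refine mul_left_cancel₀ hx ?_
    push_cast
    linear_combination -h0
  have e1 : ((2 * n + 1 : ℕ) : ℂ) * (v 0 ^ n) ^ 2 = -(v 1 ^ n) ^ 2 - b * (v 0 ^ n * v 1 ^ n) := by
    refine mul_left_cancel₀ hy ?_
    push_cast
    linear_combination h1
  have n0 := congrArg norm e0
  have n1 := congrArg norm e1
  rw [norm_mul, norm_pow, Complex.norm_natCast] at n0 n1
  have l0 := norm_add_le (-(v 0 ^ n) ^ 2) (a * (v 0 ^ n * v 1 ^ n))
  have l1 := norm_sub_le (-(v 1 ^ n) ^ 2) (b * (v 0 ^ n * v 1 ^ n))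
  rw [norm_neg, norm_pow, norm_mul, norm_mul] at l0 l1
  have hX : 0 < ‖v 0 ^ n‖ := norm_pos_iff.2 (pow_ne_zero n hx)
  have hY : 0 < ‖v 1 ^ n‖ := norm_pos_iff.2 (pow_ne_zero n hy)
  have hN : (5 : ℝ) ≤ ((2 * n + 1 : ℕ) : ℝ) := by exact_mod_cast (by omega)
  generalize ‖v 0 ^ n‖ = X at *
  generalize ‖v 1 ^ n‖ = Y at *
  have m0 := mul_le_mul_of_nonneg_right ha (mul_pos hX hY).le
  have m1 := mul_le_mul_of_nonneg_right hb (mul_pos hX hY).le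
  have m2 := mul_le_mul_of_nonneg_right hN (sq_nonneg X)
  have m3 := mul_le_mul_of_nonneg_right hN (sq_nonneg Y)
  nlinarith [sq_nonneg (X - Y), pow_pos hX 2]

theorem exists_coeffs_swapField (n : ℕ) {a b : ℂ} (hab : 1 + a * b ≠ 0) :
    ∃ p : Coeffs (2 * n + 1), lift p.1 = swapField n a b := by
  obtain ⟨f1, h1⟩ := exists_form_eq_monomial (d := 2 * n + 1) (k := 0) (m := 2 * n + 1) (by omega)
  obtain ⟨f2, h2⟩ := exists_form_eq_monomial (d := 2 * n + 1) (k := n + 1) (m := n) (by omega)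
  obtain ⟨f3, h3⟩ := exists_form_eq_monomial (d := 2 * n + 1) (k := 2 * n + 1) (m := 0) (by omega)
  obtain ⟨f4, h4⟩ := exists_form_eq_monomial (d := 2 * n + 1) (k := n) (m := n + 1) (by omega)
  have h : lift ((-1 : ℂ) • f1 + a • f2, f3 + b • f4) = swapField n a b := by
    funext v
    simp only [lift, form_add, form_smul, h1, h2, h3, h4, swapField]
    simp
  exact ⟨Coeffs.ofLift _ fun v hv => h ▸ swapField_ne_zero n hab hv, h⟩

theorem exists_coeffs_fixField {n : ℕ} (hn : 2 ≤ n) {a b : ℂ} (ha : ‖a‖ ≤ 2) (hb : ‖b‖ ≤ 2) :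
    ∃ p : Coeffs (2 * n + 1), lift p.1 = fixField n a b := by
  obtain ⟨f1, h1⟩ := exists_form_eq_monomial (d := 2 * n + 1) (k := 0) (m := 2 * n + 1) (by omega)
  obtain ⟨f2, h2⟩ := exists_form_eq_monomial (d := 2 * n + 1) (k := n + 1) (m := n) (by omega)
  obtain ⟨f3, h3⟩ := exists_form_eq_monomial (d := 2 * n + 1) (k := 2 * n + 1) (m := 0) (by omega)
  obtain ⟨f4, h4⟩ := exists_form_eq_monomial (d := 2 * n + 1) (k := n) (m := n + 1) (by omega)
  obtain ⟨f5, h5⟩ := exists_form_eq_monomial (d := 2 * n + 1) (k := 1) (m := 2 * n) (by omega)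
  obtain ⟨f6, h6⟩ := exists_form_eq_monomial (d := 2 * n + 1) (k := 2 * n) (m := 1) (by omega)
  have h : lift ((-1 : ℂ) • f3 + (-(2 * n + 1 : ℂ)) • f5 + a • f2,
      f1 + (2 * n + 1 : ℂ) • f6 + b • f4) = fixField n a b := by
    funext v
    simp only [lift, form_add, form_smul, h1, h2, h3, h4, h5, h6, fixField]
    ext i
    fin_cases i <;> simp
    ring
  exact ⟨Coeffs.ofLift _ fun v hv => h ▸ fixField_ne_zero hn ha hb hv, h⟩

theorem exists_real_smul_of_antidiagonal {x y : ℂ} (h : x * star y = 1) :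
    ∃ s : ℝ, 0 < s ∧ x = s * y := by
  have hy : y ≠ 0 := by
    rintro rfl
    simp at h
  refine ⟨(Complex.normSq y)⁻¹, inv_pos.2 (Complex.normSq_pos.2 hy), ?_⟩
  have hn : (Complex.normSq y : ℂ) ≠ 0 := Complex.ofReal_ne_zero.2 (Complex.normSq_pos.2 hy).ne'
  rw [Complex.ofReal_inv, inv_mul_eq_div, eq_div_iff hn, ← Complex.mul_conj]
  have h' : x * (starRingEnd ℂ) y = 1 := h
  linear_combination y * h'

theorem real_pow_ne_neg_one {s : ℝ} (hs : 0 < s) (n : ℕ) : (s : ℂ) ^ n ≠ -1 := by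
  intro h
  have : s ^ n = -1 := by exact_mod_cast h
  linarith [pow_pos hs n]

/-- A real map commutes with some `B` satisfying `B * conj B = 1`. In the antidiagonal case this
makes the ratio of the two entries a positive real `s`. -/
theorem not_isReal_of_diagonal_or_antidiagonal {d : ℕ} (hd : 1 ≤ d) {p : Coeffs d}
    (h : ∀ B : Matrix (Fin 2) (Fin 2) ℂ, B.det ≠ 0 → ∀ c : ℂ, c ≠ 0 →
      (∀ v, lift p.1 (B *ᵥ v) = c • B *ᵥ lift (star p.1) v) →
        ((B 0 1 = 0 ∧ B 1 0 = 0) ∨ (B 0 0 = 0 ∧ B 1 1 = 0)))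
    (hdiag : ∀ x y c : ℂ, x ≠ 0 → y ≠ 0 → c ≠ 0 →
      ¬ ∀ z w : ℂ, lift p.1 ![x * z, y * w] =
        c • ![x * lift (star p.1) ![z, w] 0, y * lift (star p.1) ![z, w] 1])
    (hanti : ∀ (y c : ℂ) (s : ℝ), y ≠ 0 → c ≠ 0 → 0 < s →
      ¬ ∀ z w : ℂ, lift p.1 ![s * y * w, y * z] =
        c • ![s * y * lift (star p.1) ![z, w] 1, y * lift (star p.1) ![z, w] 0]) :
    ¬ IsReal (Quotient.mk (proportional d) p) := by
  intro hreal
  obtain ⟨B, hB, hcomm⟩ := hreal.hasAntiInvolution hd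
  obtain ⟨c, hc, hcB⟩ := (antiMobius_commute_iff hd p B).1 hcomm
  have hdet := GeneralLinearGroup.det_ne_zero B
  rcases h B.1 hdet c hc hcB with ⟨h01, h10⟩ | ⟨h00, h11⟩
  · rw [det_fin_two, h01, zero_mul, sub_zero] at hdet
    refine hdiag _ _ c (left_ne_zero_of_mul hdet) (right_ne_zero_of_mul hdet) hc fun z w => ?_
    simpa [h01, h10] using hcB ![z, w]
  · rw [det_fin_two, h00, zero_mul, zero_sub, neg_ne_zero] at hdet
    have h1 := congrFun (congrFun hB 0) 0
    simp [Matrix.mul_apply, h00] at h1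
    obtain ⟨s, hs, hx⟩ := exists_real_smul_of_antidiagonal h1
    refine hanti (B.1 1 0) c s (right_ne_zero_of_mul hdet) hc hs fun z w => ?_
    simpa [h00, h11, hx] using hcB ![z, w]

/-- The antidiagonal matrix with entries `ω` and `1`. -/
def antidiagonalGL (ω : ℂ) (hω : ω ≠ 0) : GL (Fin 2) ℂ :=
  GeneralLinearGroup.mkOfDetNeZero !![0, ω; 1, 0] (by simpa [det_fin_two] using hω)

theorem antidiagonalGL_mulVec (ω : ℂ) (hω : ω ≠ 0) (v : Fin 2 → ℂ) :
    (antidiagonalGL ω hω).1 *ᵥ v = ![ω * v 1, v 0] := by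
  rw [show (antidiagonalGL ω hω).1 = !![0, ω; 1, 0] from rfl, mulVec_fin_two]
  simp

/-- The matrix of `z ↦ -z`. -/
def negGL : GL (Fin 2) ℂ :=
  GeneralLinearGroup.mkOfDetNeZero !![1, 0; 0, -1] (by simp [det_fin_two])

theorem negGL_mulVec (v : Fin 2 → ℂ) : negGL.1 *ᵥ v = ![v 0, -v 1] := by
  rw [show negGL.1 = !![1, 0; 0, -1] from rfl, mulVec_fin_two]
  simp

theorem trace_negGL : negGL.1.trace = 0 := by
  rw [show negGL.1 = !![1, 0; 0, -1] from rfl, trace_fin_two]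
  simp

theorem exists_pseudoReal_involution_of_odd {n : ℕ} (hn : Odd n) :
    ∃ φ : Rat (2 * n + 1), IsPseudoReal φ ∧ HasInvolution φ := by
  have hn0 : n ≠ 0 := by rintro rfl; simp at hn
  have hI := Complex.I_mul_I
  -- The coefficients are conjugate, with `a² ≠ b²` (excludes diagonal symmetries), `a + b ≠ 0`
  -- (nonzero divergence) and `1 + ab ≠ 0` (no common zeros).
  obtain ⟨a, ha⟩ : ∃ a, a = 1 - Complex.I := ⟨_, rfl⟩
  obtain ⟨b, hb⟩ : ∃ b, b = 1 + Complex.I := ⟨_, rfl⟩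
  have hab : a * b = 2 := by rw [ha, hb]; linear_combination -hI
  have ha0 : a ≠ 0 := by rintro rfl; simp at hab
  have hsq : a ^ 2 - b ^ 2 ≠ 0 := by
    rw [ha, hb, show (1 - Complex.I) ^ 2 - (1 + Complex.I) ^ 2 = -4 * Complex.I by ring]
    simp
  obtain ⟨p, hp⟩ := exists_coeffs_swapField n (a := a) (b := b) (by rw [hab]; norm_num)
  have hps : lift (star p.1) = swapField n b a := by
    funext v
    rw [lift_star_apply, hp, star_swapField, ha, hb]
    simp [sub_eq_add_neg]
  refine ⟨Quotient.mk _ p, ⟨?_, ?_⟩, negGL, trace_negGL, ?_⟩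
  -- Any `ω` with `ω ^ (n + 1) = -1` makes `z ↦ ω / conj z` a symmetry; a reflection would need a
  -- positive real in its place.
  · obtain ⟨ω, hω⟩ := IsAlgClosed.exists_pow_nat_eq (-1 : ℂ) (Nat.succ_pos n)
    have hω0 : ω ≠ 0 := by rintro rfl; simp at hω
    refine ⟨antidiagonalGL ω hω0, (antiMobius_commute_iff (by omega) p _).2
      ⟨ω ^ n, pow_ne_zero _ hω0, fun v => ?_⟩⟩
    rw [antidiagonalGL_mulVec, antidiagonalGL_mulVec, hp, hps]
    have e : ω ^ (2 * n + 1) = -ω ^ n := by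
      rw [show 2 * n + 1 = n + (n + 1) by ring, pow_add, hω]
      ring
    have e' : ω ^ n * ω = -1 := by rw [← pow_succ, hω]
    ext i
    fin_cases i
    · simp only [swapField, Pi.smul_apply, smul_eq_mul, Fin.zero_eta, cons_val_zero, cons_val_one,
        mul_pow, hω]
      linear_combination -(v 0 ^ (2 * n + 1) + a * (v 0 ^ n * v 1 ^ (n + 1))) * e'
    · simp only [swapField, Pi.smul_apply, smul_eq_mul, Fin.mk_one, cons_val_zero, cons_val_one,
        mul_pow, e]
      ring
  · refine not_isReal_of_diagonal_or_antidiagonal (by omega) ?_ ?_ ?_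
    · intro B hB c _ h
      rw [hp, hps] at h
      refine diagonal_or_antidiagonal (differentiable_swapField _ _ _)
        (differentiable_swapField _ _ _) hB h hn0 ?_ (divergence_swapField n a b)
        (divergence_swapField n b a)
      rw [ha, hb]
      refine mul_ne_zero (Nat.cast_add_one_ne_zero n) ?_
      norm_num
    · intro x y c hx hy hc h
      rw [hp, hps] at h
      have e1 := congrFun (h 0 1) 0
      have e2 := congrFun (h 1 1) 0
      have e3 := congrFun (h 1 0) 1
      have e4 := congrFun (h 1 1) 1
      simp [swapField, hn0] at e1 e2 e3 e4
      have f1 : a * (x ^ n * y ^ n) = c * b :=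
        mul_left_cancel₀ hx (by linear_combination e2 + e1)
      have f2 : b * (x ^ n * y ^ n) = c * a :=
        mul_left_cancel₀ hy (by linear_combination e4 - e3)
      refine mul_ne_zero (mul_ne_zero hc (mul_ne_zero (pow_ne_zero n hx) (pow_ne_zero n hy)))
        hsq ?_
      linear_combination c * a * f1 - c * b * f2
    · intro y c s hy hc hs h
      rw [hp, hps] at h
      have e1 := congrFun (h 1 0) 0
      have e2 := congrFun (h 1 1) 0
      simp [swapField, hn0] at e1 e2
      have hs0 : (s : ℂ) ≠ 0 := Complex.ofReal_ne_zero.2 hs.ne'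
      have f1 : (s * y) ^ n * y ^ n = c :=
        mul_left_cancel₀ (mul_ne_zero (mul_ne_zero hs0 hy) ha0) (by linear_combination e2 - e1)
      -- Substituting `c` leaves `s ^ (n + 1) = -1` after cancelling powers of `y`.
      refine real_pow_ne_neg_one hs (n + 1) ?_
      refine mul_left_cancel₀ (pow_ne_zero (2 * n + 1) hy) ?_
      rw [← f1] at e1
      linear_combination -e1
  · refine (smul_toFun_eq_iff (by omega) p p _).2 ⟨-1, by norm_num, fun v => ?_⟩
    rw [negGL_mulVec, negGL_mulVec, hp]
    have h1 : Odd (2 * n + 1) := ⟨n, rfl⟩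
    ext i
    fin_cases i
    · simp [swapField, h1.neg_pow, hn.neg_pow]
      ring
    · simp [swapField, hn.add_one.neg_pow]

theorem exists_pseudoReal_involution_of_even {n : ℕ} (hn : Even n) (hn2 : 2 ≤ n) :
    ∃ φ : Rat (2 * n + 1), IsPseudoReal φ ∧ HasInvolution φ := by
  have hn0 : n ≠ 0 := by omega
  obtain ⟨a, ha⟩ : ∃ a, a = 1 - Complex.I := ⟨_, rfl⟩
  obtain ⟨b, hb⟩ : ∃ b, b = 1 + Complex.I := ⟨_, rfl⟩
  have hI := Complex.I_mul_I
  have hab : a * b = 2 := by rw [ha, hb]; linear_combination -hI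
  have ha0 : a ≠ 0 := by rintro rfl; simp at hab
  have hsq : a ^ 2 - b ^ 2 ≠ 0 := by
    rw [ha, hb, show (1 - Complex.I) ^ 2 - (1 + Complex.I) ^ 2 = -4 * Complex.I by ring]
    simp
  have hna : ‖a‖ ≤ 2 := by
    rw [ha]
    exact (norm_sub_le _ _).trans (by norm_num)
  have hnb : ‖b‖ ≤ 2 := by
    rw [hb]
    exact (norm_add_le _ _).trans (by norm_num)
  obtain ⟨p, hp⟩ := exists_coeffs_fixField hn2 hna hnb
  have hps : lift (star p.1) = fixField n b a := by
    funext v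
    rw [lift_star_apply, hp, star_fixField, ha, hb]
    simp [sub_eq_add_neg]
  obtain ⟨ω, hω⟩ := IsAlgClosed.exists_pow_nat_eq (-1 : ℂ) (Nat.pos_of_ne_zero hn0)
  have hω0 : ω ≠ 0 := by rintro rfl; simp [hn0] at hω
  have hω1 : ω ^ (n + 1) = -ω := by rw [pow_succ, hω]; ring
  have hω2 : ω ^ (2 * n) = 1 := by rw [mul_comm, pow_mul, hω]; norm_num
  have hω3 : ω ^ (2 * n + 1) = ω := by rw [pow_succ, hω2, one_mul]
  refine ⟨Quotient.mk _ p, ⟨?_, ?_⟩, negGL, trace_negGL, ?_⟩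
  · refine ⟨antidiagonalGL ω hω0, (antiMobius_commute_iff (by omega) p _).2
      ⟨-1, by norm_num, fun v => ?_⟩⟩
    rw [antidiagonalGL_mulVec, antidiagonalGL_mulVec, hp, hps]
    ext i
    fin_cases i
    · simp only [fixField, Pi.smul_apply, smul_eq_mul, Fin.zero_eta, cons_val_zero, cons_val_one,
        mul_pow, hω1, hω3]
      ring
    · simp only [fixField, Pi.smul_apply, smul_eq_mul, Fin.mk_one, cons_val_zero, cons_val_one,
        mul_pow, hω, hω2]
      ring
  · refine not_isReal_of_diagonal_or_antidiagonal (by omega) ?_ ?_ ?_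
    · intro B hB c _ h
      rw [hp, hps] at h
      refine diagonal_or_antidiagonal (differentiable_fixField _ _ _)
        (differentiable_fixField _ _ _) hB h hn0 ?_ (divergence_fixField n a b)
        (divergence_fixField n b a)
      rw [ha, hb]
      refine mul_ne_zero (Nat.cast_add_one_ne_zero n) ?_
      norm_num
    · intro x y c hx hy hc h
      rw [hp, hps] at h
      -- As `ω ^ n = -1` and `ω ^ (2n) = 1`, replacing one coordinate by `ω` flips only the mixed
      -- monomial, so half the difference isolates it.
      have e1 := congrFun (h 1 1) 0
      have e2 := congrFun (h 1 ω) 0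
      have e3 := congrFun (h 1 1) 1
      have e4 := congrFun (h ω 1) 1
      simp [fixField, mul_pow, hω, hω1, hω2] at e1 e2 e3 e4
      have f1 : a * (x ^ n * y ^ n) = c * b :=
        mul_left_cancel₀ hx (by linear_combination (1 / 2 : ℂ) * e1 - (1 / 2 : ℂ) * e2)
      have f2 : b * (x ^ n * y ^ n) = c * a :=
        mul_left_cancel₀ hy (by linear_combination (1 / 2 : ℂ) * e3 - (1 / 2 : ℂ) * e4)
      refine mul_ne_zero (mul_ne_zero hc (mul_ne_zero (pow_ne_zero n hx) (pow_ne_zero n hy)))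
        hsq ?_
      linear_combination c * a * f1 - c * b * f2
    · intro y c s hy hc hs h
      rw [hp, hps] at h
      have e1 := congrFun (h 1 1) 0
      have e2 := congrFun (h ω 1) 0
      have e3 := congrFun (h 0 1) 0
      simp [fixField, mul_pow, hω, hω1, hω2, hn0] at e1 e2 e3
      have hs0 : (s : ℂ) ≠ 0 := Complex.ofReal_ne_zero.2 hs.ne'
      have f1 : s ^ n * y ^ n * y ^ n = c :=
        mul_left_cancel₀ (mul_ne_zero (mul_ne_zero hs0 hy) ha0)
          (by linear_combination (1 / 2 : ℂ) * e1 - (1 / 2 : ℂ) * e2)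
      refine real_pow_ne_neg_one hs n ?_
      refine mul_left_cancel₀ (mul_ne_zero (mul_ne_zero (pow_ne_zero (2 * n + 1) hy) hs0)
        (pow_ne_zero n hs0)) ?_
      rw [← f1] at e3
      linear_combination -e3
  · refine (smul_toFun_eq_iff (by omega) p p _).2 ⟨1, one_ne_zero, fun v => ?_⟩
    rw [negGL_mulVec, negGL_mulVec, hp]
    have h1 : Odd (2 * n + 1) := ⟨n, rfl⟩
    ext i
    fin_cases i
    · simp [fixField, hn.neg_pow, (even_two_mul n).neg_pow]
    · simp [fixField, h1.neg_pow, hn.add_one.neg_pow]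
      ring

end RationalMap

end

/-! ### Disconnection of the pseudo-real locus -/

open RationalMap in
theorem theorem3p6 (d : ℕ) (hd : 3 ≤ d) (hodd : Odd d) :
    ¬ IsPreconnected (RationalMap.pseudoRealLocus d) := by
  intro hconn
  have hC1 : IsClosed {c : Moduli d | ∃ φ : Rat d, (∃ r < 0, HasAntiInvolution φ r) ∧ φ.cls = c} :=
    isClosed_cls_image (fun φ ψ hc ⟨r, hr, h⟩ => ⟨r, hr, h.conjugate hc⟩)
      (isClosed_setOf_antiInvolution (by omega))
  have hC2 : IsClosed {c : Moduli d | ∃ φ : Rat d, HasInvolution φ ∧ φ.cls = c} :=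
    isClosed_cls_image (fun φ ψ hc h => h.conjugate hc) (isClosed_setOf_involution (by omega))
  obtain ⟨c, ⟨φ, hφ, rfl⟩, ⟨φ₁, ⟨r, hr, h₁⟩, e₁⟩, φ₂, h₂, e₂⟩ :=
    isPreconnected_closed_iff.1 hconn _ _ hC1 hC2 (by
      rintro _ ⟨φ, hφ, rfl⟩
      rcases hφ.1.hasInvolution_or_hasAntiInvolution (by omega) with h | ⟨r, hr, h⟩
      · exact Or.inr ⟨φ, h, rfl⟩
      · rcases lt_or_gt_of_ne hr with hr | hr
        · exact Or.inl ⟨φ, ⟨r, hr, h⟩, rfl⟩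
        · exact absurd (h.isReal (by omega) hr) hφ.2) (by
      obtain ⟨φ, hφ, h⟩ := exists_pseudoReal_antiInvolution (by omega) hodd
      exact ⟨φ.cls, ⟨φ, hφ, rfl⟩, φ, h, rfl⟩) (by
      obtain ⟨n, rfl⟩ := hodd
      obtain ⟨φ, hφ, h⟩ : ∃ φ : Rat (2 * n + 1), IsPseudoReal φ ∧ HasInvolution φ := by
        rcases Nat.even_or_odd n with hn | hn
        -- Since `d ≥ 3`, an even `n` is at least `2`; degree three falls in the odd case.
        · refine exists_pseudoReal_involution_of_even hn ?_
          obtain ⟨m, rfl⟩ := hn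
          omega
        · exact exists_pseudoReal_involution_of_odd hn
      exact ⟨φ.cls, ⟨φ, hφ, rfl⟩, φ, h, rfl⟩)
  exact hφ.2 (isReal_of_hasInvolution_of_hasAntiInvolution (by omega) hr
    (h₁.conjugate (Quotient.exact e₁)) (h₂.conjugate (Quotient.exact e₂)))
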